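/- Let $(S,\mathcal A,P)$ and $(\Omega,\mathcal F,\mathbb P)$ be probability spaces with expectations $E$ and $\mathbb E$. Let $\{c(t,x):t\ge 0,\ x\in\mathbb R\}$ be a jointly measurable, uniformly bounded, strictly stationary random field on $(S,\mathcal A,P)$ with $E\,c(t,x)=0$ for all $t\ge 0$, $x\in\mathbb R$, and let $\{B_t:t\ge 0\}$ be a standard Brownian motion on $(\Omega,\mathcal F,\mathbb P)$. Put $\Phi(t,x)=E[c(s,y)\,c(s+t,y+x)]$ for $t\ge0$, $x\in\mathbb R$, which does not depend on $s\ge 0$, $y\in\mathbb R$. For $A\subset\mathbb R_+\times\mathbb R$ let $\mathcal F_A=\sigma\{c(t,x):(t,x)\in A\}$, and for $r\ge0$ let $$\alpha_{\rm um}(r)=\sup\bigl\{|P(S_1\mid S_2)-P(S_1)|:\ A_1,A_2\subset\mathbb R_+\times\mathbb R,\ \operatorname{dist}(A_1,A_2)\ge r,\ S_1\in\mathcal F_{A_1},\ S_2\in\mathcal F_{A_2},\ P(S_2)\neq0\bigr\},$$ where $\operatorname{dist}$ is the Euclidean distance. Assume $(H_{\rm um})$: there are $C,\delta>0$ such that $\alpha_{\rm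 um}(r)\le C(1+r)^{-(2+\delta)}$ for all $r\ge 0$. For $0\le\beta\le 1/2$, $t\ge 0$, $x\in\mathbb R$ and $\varepsilon>0$ let, on the product space $(\Omega\times S,\ \mathbb P\times P)$, $$Y_t^{\varepsilon,x}=\frac1{\sqrt\varepsilon}\int_0^t c\Bigl(\frac s\varepsilon,\frac{x+B_s}{\varepsilon^\beta}\Bigr)\,ds .$$ Then for all $0\le\beta\le1/2$, $t\ge0$ and $x\in\mathbb R$, $$\lim_{\varepsilon\to0^+}E\exp(Y_t^{\varepsilon,x})=\exp\bigl(t\,\Sigma(\beta)\bigr)\quad\text{in }\mathbb P\text{-probability},$$ where $$\Sigma(\beta)=\begin{cases}\displaystyle\int_0^{\infty}\Phi(u,0)\,du,&0\le\beta<1/2,\\[2mm]\displaystyle\int_0^{\infty}\mathbb E\,\Phi(u,B_u)\,du,&\beta=1/2,\end{cases}$$ and these integrals converge absolutely. -/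

import Mathlib

open MeasureTheory ProbabilityTheory Filter Topology Set
open scoped NNReal ENNReal

namespace RandomPotential

variable {S Ω : Type*} [MeasurableSpace S] [MeasurableSpace Ω]

/-- Strict stationarity of a random field `c(t, x)`, `t ≥ 0`, `x ∈ ℝ`: the shifted field
`(t, x) ↦ c(t + h, x + y)` has the same law (on the product σ-algebra, that is, the same
finite-dimensional distributions) as `c`, for all `h ≥ 0` and `y ∈ ℝ`. -/
def Stationary (P : Measure S) (c : ℝ≥0 → ℝ → S → ℝ) : Prop :=
  ∀ (h : ℝ≥0) (y : ℝ),
    Measure.map (fun (s : S) (p : ℝ≥0 × ℝ) => c (p.1 + h) (p.2 + y) s) P =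
      Measure.map (fun (s : S) (p : ℝ≥0 × ℝ) => c p.1 p.2 s) P

/-- The σ-algebra generated by the random variables `c(t, x)`, `(t, x) ∈ A`. -/
@[reducible]
def sigmaField (c : ℝ≥0 → ℝ → S → ℝ) (A : Set (ℝ≥0 × ℝ)) : MeasurableSpace S :=
  ⨆ p ∈ A, MeasurableSpace.comap (c p.1 p.2) inferInstance

/-- `dist(A₁, A₂) ≥ r` for the Euclidean distance of the half-plane. -/
def FarApart (A₁ A₂ : Set (ℝ≥0 × ℝ)) (r : ℝ) : Prop :=
  ∀ p ∈ A₁, ∀ q ∈ A₂, r ≤ √(((p.1 : ℝ) - (q.1 : ℝ)) ^ 2 + (p.2 - q.2) ^ 2)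

/-- The numbers `|P(S₁ | S₂) - P(S₁)|` whose supremum is the uniform mixing coefficient. -/
def mixingDefects (P : Measure S) (c : ℝ≥0 → ℝ → S → ℝ) (r : ℝ) : Set ℝ :=
  {a | ∃ A₁ A₂ : Set (ℝ≥0 × ℝ), FarApart A₁ A₂ r ∧
    ∃ S₁ S₂ : Set S, MeasurableSet[sigmaField c A₁] S₁ ∧ MeasurableSet[sigmaField c A₂] S₂ ∧
      P S₂ ≠ 0 ∧ a = |(cond P S₂).real S₁ - P.real S₁|}

/-- The uniform mixing coefficient of the random field `c`. -/
noncomputable def alphaUm (P : Measure S) (c : ℝ≥0 → ℝ → S → ℝ) (r : ℝ) : ℝ :=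
  sSup (mixingDefects P c r)

/-- The supremum defining the uniform mixing coefficient is over a bounded set. -/
theorem bddAbove_mixingDefects (P : Measure S) [IsProbabilityMeasure P]
    (c : ℝ≥0 → ℝ → S → ℝ) (r : ℝ) : BddAbove (mixingDefects P c r) := by
  refine ⟨1, ?_⟩
  rintro a ⟨A₁, A₂, -, S₁, S₂, -, -, h0, rfl⟩
  have : IsProbabilityMeasure (cond P S₂) := cond_isProbabilityMeasure h0
  have h1 : (cond P S₂).real S₁ ≤ 1 := measureReal_le_one
  have h2 : P.real S₁ ≤ 1 := measureReal_le_one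
  have h3 : 0 ≤ (cond P S₂).real S₁ := measureReal_nonneg
  have h4 : 0 ≤ P.real S₁ := measureReal_nonneg
  rw [abs_le]
  constructor <;> linarith

/-- The set of mixing defects is nonempty (it contains `0`). -/
theorem zero_mem_mixingDefects (P : Measure S) [IsProbabilityMeasure P]
    (c : ℝ≥0 → ℝ → S → ℝ) (r : ℝ) : (0 : ℝ) ∈ mixingDefects P c r := by
  refine ⟨∅, ∅, fun p hp => absurd hp (by simp), ∅, univ,
    @MeasurableSet.empty _ (sigmaField c ∅), @MeasurableSet.univ _ (sigmaField c ∅),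
    by simp, by simp⟩

/-- The condition `(H_um)`: `α_um(r) ≤ C (1 + r)^{-(2+δ)}` for some `C, δ > 0`. -/
def HUm (P : Measure S) (c : ℝ≥0 → ℝ → S → ℝ) : Prop :=
  ∃ C δ : ℝ, 0 < C ∧ 0 < δ ∧ ∀ r : ℝ, 0 ≤ r → alphaUm P c r ≤ C * (1 + r) ^ (-(2 + δ))

/-- The correlation function `Φ(t, x) = E[c(0, 0) c(t, x)]`, `t ≥ 0`; for a stationary field it
equals `E[c(s, y) c(s + t, y + x)]` for all `s ≥ 0` and `y`. -/
noncomputable def corr (P : Measure S) (c : ℝ≥0 → ℝ → S → ℝ) (t : ℝ≥0) (x : ℝ) : ℝ :=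
  ∫ s, c 0 0 s * c t x s ∂P

/-- The exponent of the Feynman–Kac formula,
`Y_t^{ε,x} = ε^{-1/2} ∫_0^t c(s / ε, (x + B_s) / ε^β) ds`,
a function of the point `ω` of the Brownian space and of the point `σ` of the space of `c`. -/
noncomputable def exponent (c : ℝ≥0 → ℝ → S → ℝ) (B : ℝ≥0 → Ω → ℝ) (β : ℝ) (t : ℝ≥0) (x : ℝ)
    (ε : ℝ) (ω : Ω) (σ : S) : ℝ :=
  (√ε)⁻¹ * ∫ s in (0 : ℝ)..t, c (s / ε).toNNReal ((x + B s.toNNReal ω) / ε ^ β) σ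

/-- The integrand of `Σ(β)` at time `u`: `Φ(u, 0)` if `β < 1/2`, and `𝔼 Φ(u, B_u)` otherwise. -/
noncomputable def sigmaIntegrand (P : Measure S) (Q : Measure Ω) (c : ℝ≥0 → ℝ → S → ℝ)
    (B : ℝ≥0 → Ω → ℝ) (β : ℝ) (u : ℝ) : ℝ :=
  if β < 1 / 2 then corr P c u.toNNReal 0
  else ∫ ω, corr P c u.toNNReal (B u.toNNReal ω) ∂Q

/-- The limiting constant `Σ(β)`. -/
noncomputable def sigmaConst (P : Measure S) (Q : Measure Ω) (c : ℝ≥0 → ℝ → S → ℝ)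
    (B : ℝ≥0 → Ω → ℝ) (β : ℝ) : ℝ :=
  ∫ u in Ioi (0 : ℝ), sigmaIntegrand P Q c B β u

end RandomPotential

/-! Fix the Brownian path. The exponent is then `Z_t = ε^{-1/2} ∫_0^t W`, where `W_r` is the field
read along a deterministic space-time path. Let `M(r) = E exp Z_r`. Integrating `exp Z` by parts to
second order and taking expectations removes the centred first-order term. After the substitution `a
= r + ε u`, what remains is `M(τ) = 1 + ∫_0^τ ∫_0^{(τ-r)/ε} E[exp(Z_r) W_r W_{r+εu}] du dr`.

Uniform mixing enters through a covariance inequality whose error is proportional to the `L¹` norm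
of the past variable (`abs_integral_mul_sub_le`). Since `exp Z_r` has no useful sup bound, it is
essential that the errors are multiples of `M(r)` itself. With `θ(u) = 2K²α_um(u)`, the inner
expectation is at most `θ(u) M(r)`, and Grönwall bounds `M` uniformly in `ε` (`expMoment_le`).
Stepping back from `r` by `ε L` then decouples `exp Z` from `W_r W_{r+εu}`
(`abs_integral_exp_sub_mul_le`), so `M` almost solves `M' = k M`, where `k(r)` is the integral of
the covariances over all lags. A second use of Grönwall gives `M(t) ≈ exp(∫_0^t k)`, with an error
that does not depend on the path (`abs_expMoment_sub_exp_le`).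

By stationarity, `∫_0^t k` is the integral over `r` and `u` of `Φ(u, ·)` at the Brownian increment
from `r` to `r + ε u` divided by `ε^β`. It converges in mean to `t Σ(β)`
(`tendsto_integral_abs_pathVariance_sub`). If `β < 1/2`, the scaled increments shrink and `Φ(u, ·)`
is continuous at `0`. If `β = 1/2`, they have the law of `B_u` and are independent at time distance
at least `ε u`, so a weak law of large numbers applies. Markov's inequality concludes. -/

namespace RandomPotential

/-! ### Exponentials of primitives and Grönwall's inequality -/

theorem abs_exp_sub_exp_le {x y C : ℝ} (hx : x ≤ C) (hy : y ≤ C) :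
    |Real.exp x - Real.exp y| ≤ Real.exp C * |x - y| := by
  wlog h : y ≤ x generalizing x y
  · rw [abs_sub_comm, abs_sub_comm x]
    exact this hy hx (le_of_not_ge h)
  have h1 : 0 ≤ Real.exp x - Real.exp y := sub_nonneg.2 (Real.exp_le_exp.2 h)
  rw [abs_of_nonneg h1, abs_of_nonneg (sub_nonneg.2 h)]
  have h2 := Real.add_one_le_exp (y - x)
  have h3 : Real.exp y = Real.exp x * Real.exp (y - x) := by
    rw [← Real.exp_add]; congr 1; ring
  have h4 : Real.exp x ≤ Real.exp C := Real.exp_le_exp.2 hx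
  have h5 := Real.exp_pos x
  nlinarith [sub_nonneg.2 h]

/-- The range of `f` is bounded and `exp` is Lipschitz on it. Absolute continuity is the right
regularity here: the field is only bounded and measurable in time, so its primitives need not be
`C¹`. -/
theorem absolutelyContinuousOnInterval_exp {f : ℝ → ℝ} {a b : ℝ}
    (hf : AbsolutelyContinuousOnInterval f a b) :
    AbsolutelyContinuousOnInterval (fun x => Real.exp (f x)) a b := by
  obtain ⟨C, hC⟩ := hf.exists_bound
  rw [absolutelyContinuousOnInterval_iff] at hf ⊢
  intro ε hε
  obtain ⟨δ, hδ, h⟩ := hf (ε / Real.exp C) (by positivity)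
  refine ⟨δ, hδ, fun E hE hs => ?_⟩
  have h1 := h E hE hs
  rw [lt_div_iff₀ (Real.exp_pos C), Finset.sum_mul] at h1
  refine lt_of_le_of_lt (Finset.sum_le_sum fun i hi => ?_) h1
  rw [mul_comm, Real.dist_eq, Real.dist_eq]
  exact abs_exp_sub_exp_le ((le_abs_self _).trans (hC _ (hE.1 i hi).1))
    ((le_abs_self _).trans (hC _ (hE.1 i hi).2))

/-- The integral equation of the exponential of a primitive. -/
theorem exp_integral_eq {v : ℝ → ℝ} {τ : ℝ} (hv : IntervalIntegrable v volume 0 τ) :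
    Real.exp (∫ s in (0 : ℝ)..τ, v s) =
      1 + ∫ r in (0 : ℝ)..τ, v r * Real.exp (∫ s in (0 : ℝ)..r, v s) := by
  have hZ := hv.absolutelyContinuousOnInterval_intervalIntegral (c := 0) (by simp)
  have hF := (absolutelyContinuousOnInterval_exp hZ).integral_deriv_eq_sub
  have hd : ∫ r in (0 : ℝ)..τ, deriv (fun x => Real.exp (∫ s in (0 : ℝ)..x, v s)) r =
      ∫ r in (0 : ℝ)..τ, v r * Real.exp (∫ s in (0 : ℝ)..r, v s) := by
    apply intervalIntegral.integral_congr_ae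
    filter_upwards [hv.ae_hasDerivAt_integral] with r hr hr'
    rw [((hr (uIoc_subset_uIcc hr') 0 (by simp)).exp).deriv, mul_comm]
  simp only [intervalIntegral.integral_same, Real.exp_zero] at hF
  linarith

/-- The second order expansion of the exponential of a primitive. -/
theorem exp_integral_eq_second_order {v : ℝ → ℝ} {τ : ℝ}
    (hv : IntervalIntegrable v volume 0 τ) :
    Real.exp (∫ s in (0 : ℝ)..τ, v s) = 1 + (∫ s in (0 : ℝ)..τ, v s) +
      ∫ r in (0 : ℝ)..τ, v r * Real.exp (∫ s in (0 : ℝ)..r, v s) * ∫ a in r..τ, v a := by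
  have hZ := hv.absolutelyContinuousOnInterval_intervalIntegral (c := 0) (by simp)
  -- With `Z` the primitive of `v`, the product `exp(Z_r) (1 + Z_τ - Z_r)` runs from `1 + Z_τ` at `r
  -- = 0` to `exp(Z_τ)` at `r = τ`. In its derivative the first-order terms cancel.
  have hU : AbsolutelyContinuousOnInterval (fun r => 1 + ∫ a in r..τ, v a) 0 τ := by
    have h1 := (hv.absolutelyContinuousOnInterval_intervalIntegral (c := τ) (by simp)).fun_neg
    have h2 : AbsolutelyContinuousOnInterval (fun _ : ℝ => (1 : ℝ)) 0 τ :=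
      (LipschitzWith.const (1 : ℝ)).lipschitzOnWith.absolutelyContinuousOnInterval
    have h3 := h2.fun_add h1
    refine (congrArg (AbsolutelyContinuousOnInterval · 0 τ) (funext fun r => ?_)).mp h3
    simp only [← intervalIntegral.integral_symm]
  have hF := ((absolutelyContinuousOnInterval_exp hZ).fun_mul hU).integral_deriv_eq_sub
  have hd : ∫ r in (0 : ℝ)..τ,
      deriv (fun x => Real.exp (∫ s in (0 : ℝ)..x, v s) * (1 + ∫ a in x..τ, v a)) r =
      ∫ r in (0 : ℝ)..τ, v r * Real.exp (∫ s in (0 : ℝ)..r, v s) * ∫ a in r..τ, v a := by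
    apply intervalIntegral.integral_congr_ae
    filter_upwards [hv.ae_hasDerivAt_integral] with r hr hr'
    have h1 := (hr (uIoc_subset_uIcc hr') 0 (by simp)).exp
    have h2 := ((hr (uIoc_subset_uIcc hr') τ (by simp)).neg).const_add 1
    have h3 : HasDerivAt (fun x => 1 + ∫ a in x..τ, v a) (-v r) r := by
      refine h2.congr_of_eventuallyEq (Eventually.of_forall fun x => ?_)
      simp only [Pi.neg_apply, ← intervalIntegral.integral_symm]
    rw [(h1.fun_mul h3).deriv]
    ring
  simp only [intervalIntegral.integral_same, Real.exp_zero] at hF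
  linarith

/-- **Grönwall's inequality** in integral form. -/
theorem le_mul_exp_of_le_add_integral {f : ℝ → ℝ} {t A C : ℝ}
    (hf : ContinuousOn f (Icc 0 t)) (hC : 0 ≤ C)
    (h : ∀ τ ∈ Icc 0 t, f τ ≤ A + C * ∫ r in (0 : ℝ)..τ, f r) :
    ∀ τ ∈ Icc 0 t, f τ ≤ A * Real.exp (C * τ) := by
  intro τ hτ
  have ht : 0 ≤ t := hτ.1.trans hτ.2
  have hint : IntervalIntegrable f volume 0 t := by
    apply ContinuousOn.intervalIntegrable; rwa [uIcc_of_le ht]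
  set G : ℝ → ℝ := fun x => (A + C * ∫ r in (0 : ℝ)..x, f r) * Real.exp (-(C * x)) with hG
  have hcont : ContinuousOn G (Icc 0 t) := by
    have : ContinuousOn (fun x => ∫ r in (0 : ℝ)..x, f r) (Icc 0 t) := by
      have := intervalIntegral.continuousOn_primitive_interval' hint (a := 0) (by simp)
      rwa [uIcc_of_le ht] at this
    fun_prop
  have hderiv : ∀ x ∈ Ioo 0 t, HasDerivAt G
      (C * f x * Real.exp (-(C * x)) +
        (A + C * ∫ r in (0 : ℝ)..x, f r) * (Real.exp (-(C * x)) * (-(C * 1)))) x := by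
    intro x hx
    have h1 : HasDerivAt (fun x => ∫ r in (0 : ℝ)..x, f r) (f x) x := by
      apply intervalIntegral.integral_hasDerivAt_right
      · exact hint.mono_set (by
          rw [uIcc_of_le hx.1.le, uIcc_of_le ht]; exact Icc_subset_Icc_right hx.2.le)
      · exact (hf.mono Ioo_subset_Icc_self).stronglyMeasurableAtFilter isOpen_Ioo x hx
      · exact hf.continuousAt (Icc_mem_nhds hx.1 hx.2)
    exact ((h1.const_mul C).const_add A).mul (((hasDerivAt_id x).const_mul C).neg.exp)
  have hanti : AntitoneOn G (Icc 0 t) := by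
    apply antitoneOn_of_deriv_nonpos (convex_Icc 0 t) hcont
    · intro x hx
      rw [interior_Icc] at hx
      exact (hderiv x hx).differentiableAt.differentiableWithinAt
    · intro x hx
      rw [interior_Icc] at hx
      rw [(hderiv x hx).deriv]
      have h1 := h x (Ioo_subset_Icc_self hx)
      have h2 := Real.exp_pos (-(C * x))
      have : C * Real.exp (-(C * x)) * (f x - (A + C * ∫ r in (0 : ℝ)..x, f r)) ≤ 0 :=
        mul_nonpos_of_nonneg_of_nonpos (by positivity) (by linarith)
      linarith
  have h1 : G τ ≤ G 0 := hanti ⟨le_rfl, ht⟩ hτ hτ.1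
  have h2 : G 0 = A := by simp [hG]
  rw [h2] at h1
  calc f τ ≤ A + C * ∫ r in (0 : ℝ)..τ, f r := h τ hτ
    _ = G τ * Real.exp (C * τ) := by
      simp only [hG]
      rw [mul_assoc, ← Real.exp_add, neg_add_cancel, Real.exp_zero, mul_one]
    _ ≤ A * Real.exp (C * τ) := by gcongr

theorem abs_exp_sub_one_le (x : ℝ) : |Real.exp x - 1| ≤ Real.exp |x| - 1 := by
  rcases le_total 0 x with h | h
  · rw [abs_of_nonneg h, abs_of_nonneg (sub_nonneg.2 (Real.one_le_exp h))]
  · rw [abs_of_nonpos h, abs_of_nonpos (sub_nonpos.2 (Real.exp_le_one_iff.2 h))]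
    have h1 := Real.exp_pos x
    have h2 : Real.exp x * Real.exp (-x) = 1 := by rw [← Real.exp_add]; simp
    nlinarith [sq_nonneg (Real.exp x - 1), sq_nonneg (Real.exp (-x) - 1)]

/-! ### The second-order expansion of the exponential moment -/

section Expansion

variable {S : Type*}

/-- `Z_r = ε^{-1/2} ∫_0^r W`. -/
noncomputable def scaledPrimitive (ε : ℝ) (W : ℝ → S → ℝ) (r : ℝ) (s : S) : ℝ :=
  (√ε)⁻¹ * ∫ a in (0 : ℝ)..r, W a s

@[simp]
theorem scaledPrimitive_zero (ε : ℝ) (W : ℝ → S → ℝ) (s : S) : scaledPrimitive ε W 0 s = 0 := by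
  simp [scaledPrimitive]

theorem mul_lag_le {W : ℝ → S → ℝ} {K : ℝ} (hK : ∀ r s, |W r s| ≤ K) (r a : ℝ) (s : S) :
    |W r s * W a s| ≤ K * K := by
  rw [abs_mul]
  exact mul_le_mul (hK r s) (hK a s) (abs_nonneg _) ((abs_nonneg _).trans (hK r s))

variable [MeasurableSpace S]

theorem integral_intervalIntegral_swap {P : Measure S} [IsProbabilityMeasure P]
    {f : ℝ → S → ℝ} (hf : Measurable (Function.uncurry f)) {a b C : ℝ} (hab : a ≤ b)
    (hC : ∀ r ∈ Ioc a b, ∀ s, |f r s| ≤ C) :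
    ∫ s, (∫ r in a..b, f r s) ∂P = ∫ r in a..b, (∫ s, f r s ∂P) := by
  simp only [intervalIntegral.integral_of_le hab]
  refine integral_integral_swap (f := fun s r => f r s) ?_
  have h1 : Measurable (Function.uncurry fun (s : S) (r : ℝ) => f r s) :=
    hf.comp measurable_swap
  refine Integrable.of_bound h1.aestronglyMeasurable C ?_
  have h2 : ∀ᵐ p ∂(P.prod (volume.restrict (Ioc a b))), p.2 ∈ Ioc a b := by
    have := (Measure.quasiMeasurePreserving_snd (μ := P)
      (ν := (volume : Measure ℝ).restrict (Ioc a b))).ae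
      (ae_restrict_mem measurableSet_Ioc)
    exact this
  filter_upwards [h2] with p hp
  exact hC p.2 hp p.1

/-- The exponential moment of `Z_r`. -/
noncomputable def expMoment (P : Measure S) (ε : ℝ) (W : ℝ → S → ℝ) (r : ℝ) : ℝ :=
  ∫ s, Real.exp (scaledPrimitive ε W r s) ∂P

/-- The covariance of `W` at the times `r` and `r + ε u`. -/
noncomputable def lagCov (P : Measure S) (ε : ℝ) (W : ℝ → S → ℝ) (r u : ℝ) : ℝ :=
  ∫ s, W r s * W (r + ε * u) s ∂P

/-- A bounded measurable centred process whose dependence between the times `r` and `r + ε u`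
is controlled by `θ u`. -/
structure WeaklyDependent (P : Measure S) (ε K : ℝ) (W : ℝ → S → ℝ) (θ : ℝ → ℝ) : Prop where
  measurable : Measurable (Function.uncurry W)
  bdd : ∀ r s, |W r s| ≤ K
  centered : ∀ r, 0 ≤ r → ∫ s, W r s ∂P = 0
  abs_lagCov_le : ∀ r u, 0 ≤ r → 0 ≤ u → |lagCov P ε W r u| ≤ θ u
  abs_integral_exp_le : ∀ r u, 0 ≤ r → 0 ≤ u →
    |∫ s, Real.exp (scaledPrimitive ε W r s) * (W r s * W (r + ε * u) s) ∂P|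
      ≤ θ u * expMoment P ε W r
  abs_integral_exp_sub_le : ∀ g r u, 0 ≤ g → g ≤ r → 0 ≤ u →
    |∫ s, Real.exp (scaledPrimitive ε W g s) * (W r s * W (r + ε * u) s) ∂P
      - expMoment P ε W g * lagCov P ε W r u| ≤ θ ((r - g) / ε) * expMoment P ε W g

variable {P : Measure S} [IsProbabilityMeasure P] {ε K : ℝ} {W : ℝ → S → ℝ}

theorem intervalIntegrable_path (hW : Measurable (Function.uncurry W))
    (hK : ∀ r s, |W r s| ≤ K) (s : S) (a b : ℝ) :
    IntervalIntegrable (fun r => W r s) volume a b := by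
  have hm : Measurable fun r => W r s := hW.comp (measurable_id.prodMk measurable_const)
  rw [intervalIntegrable_iff]
  exact Measure.integrableOn_of_bounded (M := K) (by simp) hm.aestronglyMeasurable
    (Eventually.of_forall fun r => hK r s)

theorem abs_scaledPrimitive_sub_le (hW : Measurable (Function.uncurry W))
    (hK : ∀ r s, |W r s| ≤ K) (a b : ℝ) (s : S) :
    |scaledPrimitive ε W b s - scaledPrimitive ε W a s| ≤ (√ε)⁻¹ * (K * |b - a|) := by
  unfold scaledPrimitive
  rw [← mul_sub, intervalIntegral.integral_interval_sub_left
    (intervalIntegrable_path hW hK s _ _) (intervalIntegrable_path hW hK s _ _), abs_mul,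
    abs_of_nonneg (by positivity : (0 : ℝ) ≤ (√ε)⁻¹)]
  gcongr
  exact intervalIntegral.norm_integral_le_of_norm_le_const (f := fun r => W r s)
    fun r _ => hK r s

theorem abs_scaledPrimitive_le (hW : Measurable (Function.uncurry W))
    (hK : ∀ r s, |W r s| ≤ K) (b : ℝ) (s : S) :
    |scaledPrimitive ε W b s| ≤ (√ε)⁻¹ * (K * |b|) := by
  simpa using abs_scaledPrimitive_sub_le (ε := ε) hW hK 0 b s

theorem measurable_scaledPrimitive (hW : Measurable (Function.uncurry W))
    (hK : ∀ r s, |W r s| ≤ K) :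
    Measurable (Function.uncurry (scaledPrimitive ε W)) := by
  have h := measurable_uncurry_of_continuous_of_measurable
    (m := inferInstance) (u := fun (r : ℝ) (s : S) => scaledPrimitive ε W r s) ?_ ?_
  · exact h
  · intro s
    unfold scaledPrimitive
    exact (intervalIntegral.continuous_primitive
      (fun a b => intervalIntegrable_path hW hK s a b) 0).const_mul _
  · intro r
    unfold scaledPrimitive
    refine Measurable.const_mul ?_ _
    simp only [intervalIntegral]
    have hs : StronglyMeasurable (Function.uncurry fun (s : S) (a : ℝ) => W a s) :=
      (hW.comp measurable_swap).stronglyMeasurable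
    exact (hs.integral_prod_right.measurable).sub (hs.integral_prod_right.measurable)

theorem measurable_scaledPrimitive_apply (hW : Measurable (Function.uncurry W))
    (hK : ∀ r s, |W r s| ≤ K) (r : ℝ) : Measurable (scaledPrimitive ε W r) :=
  (measurable_scaledPrimitive hW hK).comp measurable_prodMk_left

theorem measurable_apply (hW : Measurable (Function.uncurry W)) (r : ℝ) : Measurable (W r) :=
  hW.comp measurable_prodMk_left

theorem integrable_exp_mul (hW : Measurable (Function.uncurry W))
    (hK : ∀ r s, |W r s| ≤ K) (r : ℝ) {h : S → ℝ} (hh : Measurable h) {C : ℝ}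
    (hC : ∀ s, |h s| ≤ C) :
    Integrable (fun s => Real.exp (scaledPrimitive ε W r s) * h s) P := by
  refine Integrable.of_bound (C := Real.exp ((√ε)⁻¹ * (K * |r|)) * C)
    (((measurable_scaledPrimitive_apply hW hK r).exp.mul hh).aestronglyMeasurable)
    (Eventually.of_forall fun s => ?_)
  rw [norm_mul, Real.norm_eq_abs, Real.norm_eq_abs, Real.abs_exp]
  gcongr
  · exact (le_abs_self _).trans (abs_scaledPrimitive_le hW hK r s)
  · exact hC s

theorem integrable_exp (hW : Measurable (Function.uncurry W))
    (hK : ∀ r s, |W r s| ≤ K) (r : ℝ) :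
    Integrable (fun s => Real.exp (scaledPrimitive ε W r s)) P := by
  simpa using integrable_exp_mul (P := P) (ε := ε) hW hK r (h := fun _ => 1) measurable_const
    (C := 1) (by simp)

theorem expMoment_pos (hW : Measurable (Function.uncurry W))
    (hK : ∀ r s, |W r s| ≤ K) (r : ℝ) : 0 < expMoment P ε W r :=
  integral_exp_pos (integrable_exp hW hK r)

@[simp]
theorem expMoment_zero : expMoment P ε W 0 = 1 := by simp [expMoment]

theorem continuous_expMoment (hW : Measurable (Function.uncurry W))
    (hK : ∀ r s, |W r s| ≤ K) : Continuous (expMoment P ε W) := by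
  rw [continuous_iff_continuousAt]
  intro r
  refine continuousAt_of_dominated (bound := fun _ => Real.exp ((√ε)⁻¹ * (|K| * (|r| + 1))))
    (Eventually.of_forall fun r => (integrable_exp hW hK r).aestronglyMeasurable) ?_
    (integrable_const _) ?_
  · have h1 : ∀ᶠ y in 𝓝 r, |y| < |r| + 1 :=
      (continuous_abs.tendsto r).eventually (gt_mem_nhds (by linarith))
    filter_upwards [h1] with y hy
    refine Eventually.of_forall fun s => ?_
    rw [Real.norm_eq_abs, Real.abs_exp]
    gcongr
    refine (le_abs_self _).trans ((abs_scaledPrimitive_le hW hK y s).trans ?_)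
    gcongr
    exact le_abs_self K
  · refine Eventually.of_forall fun s => ?_
    unfold scaledPrimitive
    exact (((intervalIntegral.continuous_primitive
      (fun a b => intervalIntegrable_path hW hK s a b) 0).const_mul _).rexp).continuousAt

/-- The integrand of the expansion of `expMoment`. -/
noncomputable def expansionIntegrand (P : Measure S) (ε : ℝ) (W : ℝ → S → ℝ) (τ r : ℝ) : ℝ :=
  ∫ s, Real.exp (scaledPrimitive ε W r s) * ((√ε)⁻¹ * W r s *
    (scaledPrimitive ε W τ s - scaledPrimitive ε W r s)) ∂P

theorem abs_expansion_le (hW : Measurable (Function.uncurry W))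
    (hK : ∀ r s, |W r s| ≤ K) {τ r : ℝ} (hr : r ∈ Ioc 0 τ) (s : S) :
    |Real.exp (scaledPrimitive ε W r s) * ((√ε)⁻¹ * W r s *
      (scaledPrimitive ε W τ s - scaledPrimitive ε W r s))| ≤
      Real.exp ((√ε)⁻¹ * (K * τ)) * ((√ε)⁻¹ * K * ((√ε)⁻¹ * (K * τ))) := by
  have hK0 : 0 ≤ K := (abs_nonneg _).trans (hK 0 s)
  rw [abs_mul, abs_mul, abs_mul, Real.abs_exp, abs_of_nonneg (by positivity : (0:ℝ) ≤ (√ε)⁻¹)]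
  gcongr
  · refine (le_abs_self _).trans ((abs_scaledPrimitive_le hW hK r s).trans ?_)
    gcongr
    rw [abs_of_pos hr.1]; exact hr.2
  · exact hK r s
  · refine (abs_scaledPrimitive_sub_le hW hK r τ s).trans ?_
    gcongr
    rw [abs_of_nonneg (by linarith [hr.2])]; linarith [hr.1]

theorem measurable_expansion (hW : Measurable (Function.uncurry W))
    (hK : ∀ r s, |W r s| ≤ K) (τ : ℝ) :
    Measurable (Function.uncurry fun (r : ℝ) (s : S) =>
      Real.exp (scaledPrimitive ε W r s) * ((√ε)⁻¹ * W r s *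
        (scaledPrimitive ε W τ s - scaledPrimitive ε W r s))) := by
  have h1 := measurable_scaledPrimitive (ε := ε) hW hK
  have h2 := (measurable_scaledPrimitive_apply (ε := ε) hW hK τ).comp
    (measurable_snd : Measurable (Prod.snd : ℝ × S → S))
  exact h1.exp.mul ((hW.const_mul _).mul (h2.sub h1))

theorem intervalIntegrable_expansionIntegrand (hW : Measurable (Function.uncurry W))
    (hK : ∀ r s, |W r s| ≤ K) {τ : ℝ} (hτ : 0 ≤ τ) :
    IntervalIntegrable (expansionIntegrand P ε W τ) volume 0 τ := by
  rw [intervalIntegrable_iff, uIoc_of_le hτ]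
  have h1 := (measurable_expansion (ε := ε) hW hK τ).stronglyMeasurable
  refine Measure.integrableOn_of_bounded
    (M := Real.exp ((√ε)⁻¹ * (K * τ)) * ((√ε)⁻¹ * K * ((√ε)⁻¹ * (K * τ)))) (by simp)
    (h1.integral_prod_right (ν := P)).aestronglyMeasurable ?_
  filter_upwards [ae_restrict_mem measurableSet_Ioc] with r hr
  refine (norm_integral_le_of_norm_le_const (μ := P) (Eventually.of_forall fun s =>
    abs_expansion_le hW hK hr s)).trans ?_
  simp

/-- This is the expectation of the pathwise second-order expansion. The linear term disappears
because `W` is centred. -/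
theorem expMoment_eq (hW : Measurable (Function.uncurry W)) (hK : ∀ r s, |W r s| ≤ K)
    (hc : ∀ r, 0 ≤ r → ∫ s, W r s ∂P = 0) {τ : ℝ} (hτ : 0 ≤ τ) :
    expMoment P ε W τ = 1 + ∫ r in (0 : ℝ)..τ, expansionIntegrand P ε W τ r := by
  have hpath : ∀ s, Real.exp (scaledPrimitive ε W τ s) = 1 + scaledPrimitive ε W τ s +
      ∫ r in (0 : ℝ)..τ, Real.exp (scaledPrimitive ε W r s) * ((√ε)⁻¹ * W r s *
        (scaledPrimitive ε W τ s - scaledPrimitive ε W r s)) := by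
    intro s
    have h := exp_integral_eq_second_order
      ((intervalIntegrable_path hW hK s 0 τ).const_mul (√ε)⁻¹)
    simp only [intervalIntegral.integral_const_mul] at h
    refine h.trans ?_
    congr 1
    refine intervalIntegral.integral_congr fun r _ => ?_
    simp only [scaledPrimitive]
    rw [← mul_sub, intervalIntegral.integral_interval_sub_left
      (intervalIntegrable_path hW hK s _ _) (intervalIntegrable_path hW hK s _ _)]
    ring
  have hZint : Integrable (scaledPrimitive ε W τ) P :=
    Integrable.of_bound (measurable_scaledPrimitive_apply hW hK τ).aestronglyMeasurable _
      (Eventually.of_forall fun s => abs_scaledPrimitive_le hW hK τ s)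
  have hZ0 : ∫ s, scaledPrimitive ε W τ s ∂P = 0 := by
    unfold scaledPrimitive
    rw [integral_const_mul, integral_intervalIntegral_swap hW hτ (fun r _ s => hK r s)]
    rw [intervalIntegral.integral_congr (g := fun _ => (0 : ℝ))]
    · simp
    · intro r hr
      rw [uIcc_of_le hτ] at hr
      exact hc r hr.1
  have hswap := integral_intervalIntegral_swap (P := P) (measurable_expansion (ε := ε) hW hK τ) hτ
    (fun r hr s => abs_expansion_le hW hK hr s)
  have hint : Integrable (fun s => ∫ r in (0 : ℝ)..τ, Real.exp (scaledPrimitive ε W r s) *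
      ((√ε)⁻¹ * W r s * (scaledPrimitive ε W τ s - scaledPrimitive ε W r s))) P := by
    have h1 : Integrable (fun s => Real.exp (scaledPrimitive ε W τ s) -
        (1 + scaledPrimitive ε W τ s)) P :=
      (integrable_exp hW hK τ).sub ((integrable_const _).add hZint)
    refine h1.congr (Eventually.of_forall fun s => ?_)
    simp only [hpath s]
    ring
  unfold expMoment
  simp only [hpath]
  have h1Z : Integrable (fun s => 1 + scaledPrimitive ε W τ s) P :=
    (integrable_const _).add hZint
  rw [integral_add h1Z hint, integral_add (integrable_const _) hZint, hZ0, hswap]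
  simp [expansionIntegrand]

/-- Substituting `a = r + ε u` expresses the lag in the time scale of the mixing. The Jacobian `ε`
absorbs the two factors `ε^{-1/2}`, so no negative power of `ε` is left. -/
theorem expansionIntegrand_eq (hW : Measurable (Function.uncurry W)) (hK : ∀ r s, |W r s| ≤ K)
    (hε : 0 < ε) {τ r : ℝ} (hr : r ≤ τ) :
    expansionIntegrand P ε W τ r = ∫ u in (0 : ℝ)..(τ - r) / ε,
      ∫ s, Real.exp (scaledPrimitive ε W r s) * (W r s * W (r + ε * u) s) ∂P := by
  have hm : Measurable (Function.uncurry fun (u : ℝ) (s : S) =>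
      Real.exp (scaledPrimitive ε W r s) * (W r s * W (r + ε * u) s)) := by
    have h1 := (measurable_scaledPrimitive_apply (ε := ε) hW hK r).comp
      (measurable_snd : Measurable (Prod.snd : ℝ × S → S))
    have h2 := (measurable_apply hW r).comp (measurable_snd : Measurable (Prod.snd : ℝ × S → S))
    have h3 : Measurable fun p : ℝ × S => W (r + ε * p.1) p.2 :=
      hW.comp (Measurable.prodMk (by fun_prop) measurable_snd)
    exact h1.exp.mul (h2.mul h3)
  have hr' : 0 ≤ (τ - r) / ε := div_nonneg (sub_nonneg.2 hr) hε.le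
  rw [← integral_intervalIntegral_swap (P := P) hm hr'
    (C := Real.exp ((√ε)⁻¹ * (K * |r|)) * (K * K)) ?_]
  · unfold expansionIntegrand
    congr 1
    funext s
    simp only [intervalIntegral.integral_const_mul]
    congr 1
    have h4 := intervalIntegral.integral_comp_add_mul (a := 0) (b := (τ - r) / ε)
      (fun a => W a s) hε.ne' r
    rw [h4, mul_zero, add_zero, mul_div_cancel₀ _ hε.ne', add_sub_cancel]
    unfold scaledPrimitive
    rw [← mul_sub, intervalIntegral.integral_interval_sub_left
      (intervalIntegrable_path hW hK s _ _) (intervalIntegrable_path hW hK s _ _), smul_eq_mul]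
    have h5 : (√ε)⁻¹ * (√ε)⁻¹ = ε⁻¹ := by rw [← mul_inv, Real.mul_self_sqrt hε.le]
    rw [← h5]
    ring
  · intro u _ s
    rw [abs_mul, Real.abs_exp]
    gcongr
    · exact (le_abs_self _).trans (abs_scaledPrimitive_le hW hK r s)
    · exact mul_lag_le hK _ _ s

end Expansion

/-! ### Elementary bounds for integrals -/

theorem abs_integral_le_of_abs_le {α : Type*} [MeasurableSpace α] {μ : Measure α} {f g : α → ℝ}
    (hg : Integrable g μ) (h : ∀ᵐ a ∂μ, |f a| ≤ g a) : |∫ a, f a ∂μ| ≤ ∫ a, g a ∂μ :=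
  norm_integral_le_of_norm_le (f := f) hg h

theorem abs_integral_le_of_abs_le_const {α : Type*} [MeasurableSpace α] {μ : Measure α}
    [IsProbabilityMeasure μ] {f : α → ℝ} {C : ℝ} (h : ∀ a, |f a| ≤ C) : |∫ a, f a ∂μ| ≤ C := by
  simpa using norm_integral_le_of_norm_le_const (μ := μ) (f := f) (Eventually.of_forall h)

theorem abs_intervalIntegral_le_of_abs_le {f g : ℝ → ℝ} {a b : ℝ} (hab : a ≤ b)
    (h : ∀ r ∈ Ioc a b, |f r| ≤ g r) (hg : IntervalIntegrable g volume a b) :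
    |∫ r in a..b, f r| ≤ ∫ r in a..b, g r :=
  intervalIntegral.norm_integral_le_of_norm_le (f := f) hab (Eventually.of_forall h) hg

theorem intervalIntegrable_tail {θ : ℝ → ℝ} (hθ0 : ∀ u, 0 ≤ u → 0 ≤ θ u) {ε : ℝ} (hε : 0 < ε)
    (hθ : IntegrableOn θ (Ioi 0)) {t : ℝ} (ht : 0 ≤ t) :
    IntervalIntegrable (fun r => ∫ u in Ioi (r / ε), θ u) volume 0 t := by
  have hanti : AntitoneOn (fun r => ∫ u in Ioi (r / ε), θ u) (uIcc 0 t) := by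
    rw [uIcc_of_le ht]
    intro a ha b hb hab
    have hab' : a / ε ≤ b / ε := by gcongr
    have ha' : 0 ≤ a / ε := div_nonneg ha.1 hε.le
    refine setIntegral_mono_set (hθ.mono_set (Ioi_subset_Ioi ha')) ?_
      (Ioi_subset_Ioi hab').eventuallyLE
    filter_upwards [ae_restrict_mem measurableSet_Ioi] with u hu
    exact hθ0 _ (ha'.trans (le_of_lt hu))
  exact hanti.intervalIntegrable

/-! ### Comparison of the exponential moment with the exponential of the integrated covariance -/

section Comparison

variable {S : Type*} [MeasurableSpace S]

/-- The rate `∫_0^∞ E[W_r W_{r + ε u}] du` of the variance at the time `r`. -/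
noncomputable def lagRate (P : Measure S) (ε : ℝ) (W : ℝ → S → ℝ) (r : ℝ) : ℝ :=
  ∫ u in Ioi (0 : ℝ), lagCov P ε W r u

variable {P : Measure S} {ε K : ℝ} {W : ℝ → S → ℝ} {θ : ℝ → ℝ}

theorem stronglyMeasurable_lagCov [IsProbabilityMeasure P] (hW : Measurable (Function.uncurry W)) :
    StronglyMeasurable (Function.uncurry (lagCov P ε W)) := by
  have h1 : Measurable fun p : (ℝ × ℝ) × S => W p.1.1 p.2 * W (p.1.1 + ε * p.1.2) p.2 :=
    (hW.comp (Measurable.prodMk (by fun_prop) measurable_snd)).mul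
      (hW.comp (Measurable.prodMk (by fun_prop) measurable_snd))
  exact h1.stronglyMeasurable.integral_prod_right

namespace WeaklyDependent

theorem theta_nonneg (h : WeaklyDependent P ε K W θ) {u : ℝ} (hu : 0 ≤ u) : 0 ≤ θ u :=
  (abs_nonneg _).trans (h.abs_lagCov_le 0 u le_rfl hu)

theorem integrableOn_lagCov [IsProbabilityMeasure P] (h : WeaklyDependent P ε K W θ)
    (hθ : IntegrableOn θ (Ioi 0))
    {r : ℝ} (hr : 0 ≤ r) : IntegrableOn (lagCov P ε W r) (Ioi 0) := by
  refine Integrable.mono' hθ ((stronglyMeasurable_lagCov h.measurable).comp_measurable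
    measurable_prodMk_left).aestronglyMeasurable ?_
  filter_upwards [ae_restrict_mem measurableSet_Ioi] with u hu
  exact h.abs_lagCov_le r u hr (le_of_lt hu)

theorem abs_lagRate_le (h : WeaklyDependent P ε K W θ) (hθ : IntegrableOn θ (Ioi 0))
    {r : ℝ} (hr : 0 ≤ r) : |lagRate P ε W r| ≤ ∫ u in Ioi (0 : ℝ), θ u := by
  refine abs_integral_le_of_abs_le hθ ?_
  filter_upwards [ae_restrict_mem measurableSet_Ioi] with u hu
  exact h.abs_lagCov_le r u hr (le_of_lt hu)

theorem integral_theta_nonneg (h : WeaklyDependent P ε K W θ) :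
    0 ≤ ∫ u in Ioi (0 : ℝ), θ u :=
  setIntegral_nonneg measurableSet_Ioi fun _ hu => h.theta_nonneg (le_of_lt hu)

variable [IsProbabilityMeasure P]

theorem intervalIntegrable_lagRate (h : WeaklyDependent P ε K W θ) (hθ : IntegrableOn θ (Ioi 0))
    {t : ℝ} (ht : 0 ≤ t) : IntervalIntegrable (lagRate P ε W) volume 0 t := by
  rw [intervalIntegrable_iff, uIoc_of_le ht]
  refine Measure.integrableOn_of_bounded (M := ∫ u in Ioi (0 : ℝ), θ u) (by simp)
    ((stronglyMeasurable_lagCov h.measurable).integral_prod_right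
      (ν := volume.restrict (Ioi 0))).aestronglyMeasurable ?_
  filter_upwards [ae_restrict_mem measurableSet_Ioc] with r hr
  exact h.abs_lagRate_le hθ hr.1.le

/-- The integrand of the expansion is at most `expMoment P ε W r` times the integral of `θ`, so
Grönwall applies. The resulting bound does not involve `ε`, unlike the pathwise bound `exp(ε^{-1/2}
K τ)`. -/
theorem expMoment_le (h : WeaklyDependent P ε K W θ) (hε : 0 < ε) (hθ : IntegrableOn θ (Ioi 0))
    {τ : ℝ} (hτ : 0 ≤ τ) :
    expMoment P ε W τ ≤ Real.exp ((∫ u in Ioi (0 : ℝ), θ u) * τ) := by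
  have hcont : Continuous (expMoment P ε W) := continuous_expMoment h.measurable h.bdd
  have key := le_mul_exp_of_le_add_integral (f := expMoment P ε W) (t := τ) (A := 1)
    (C := ∫ u in Ioi (0 : ℝ), θ u) hcont.continuousOn h.integral_theta_nonneg ?_ τ ⟨hτ, le_rfl⟩
  · simpa using key
  intro x hx
  rw [expMoment_eq h.measurable h.bdd h.centered hx.1, ← intervalIntegral.integral_const_mul]
  gcongr
  refine (le_abs_self _).trans (abs_intervalIntegral_le_of_abs_le hx.1 ?_
    ((hcont.intervalIntegrable _ _).const_mul _))
  intro r hr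
  rw [expansionIntegrand_eq h.measurable h.bdd hε hr.2]
  have hx' : 0 ≤ (x - r) / ε := div_nonneg (sub_nonneg.2 hr.2) hε.le
  have hθm := hθ.mul_const (expMoment P ε W r)
  have h1 : IntegrableOn (fun u => θ u * expMoment P ε W r) (Ioc 0 ((x - r) / ε)) :=
    IntegrableOn.mono_set hθm Ioc_subset_Ioi_self
  refine (abs_intervalIntegral_le_of_abs_le hx' (g := fun u => θ u * expMoment P ε W r)
    (fun u hu => h.abs_integral_exp_le r u hr.1.le hu.1.le)
    ((intervalIntegrable_iff_integrableOn_Ioc_of_le hx').2 h1)).trans ?_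
  rw [intervalIntegral.integral_of_le hx', ← integral_mul_const]
  refine setIntegral_mono_set hθm ?_ Ioc_subset_Ioi_self.eventuallyLE
  filter_upwards [ae_restrict_mem measurableSet_Ioi] with u hu
  exact mul_nonneg (h.theta_nonneg (le_of_lt hu)) (expMoment_pos h.measurable h.bdd r).le

theorem expMoment_le_of_le (h : WeaklyDependent P ε K W θ) (hε : 0 < ε)
    (hθ : IntegrableOn θ (Ioi 0)) {τ t : ℝ} (hτ : 0 ≤ τ) (hτt : τ ≤ t) :
    expMoment P ε W τ ≤ Real.exp ((∫ u in Ioi (0 : ℝ), θ u) * t) := by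
  refine (h.expMoment_le hε hθ hτ).trans ?_
  gcongr
  exact h.integral_theta_nonneg

/-- A bound for the cost of decorrelating across a gap of length `ε L`. -/
noncomputable def gapError (ε K L : ℝ) (θ : ℝ → ℝ) : ℝ :=
  2 * (K * K * (Real.exp ((√ε)⁻¹ * (K * (ε * L))) - 1)) + θ L

theorem K_nonneg (h : WeaklyDependent P ε K W θ) : 0 ≤ K := by
  obtain ⟨s⟩ := nonempty_of_isProbabilityMeasure P
  exact (abs_nonneg _).trans (h.bdd 0 s)

theorem gapError_nonneg (h : WeaklyDependent P ε K W θ) (hε : 0 < ε) {L : ℝ} (hL : 0 ≤ L) :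
    0 ≤ gapError ε K L θ := by
  have h1 := h.theta_nonneg hL
  have h2 := h.K_nonneg
  have h3 : 0 ≤ (√ε)⁻¹ * (K * (ε * L)) := by positivity
  have h4 := Real.one_le_exp h3
  unfold gapError
  positivity

theorem abs_lagCov_le_sq (h : WeaklyDependent P ε K W θ) (r u : ℝ) :
    |lagCov P ε W r u| ≤ K * K := by
  exact abs_integral_le_of_abs_le_const fun s => mul_lag_le h.bdd _ _ s

/-- The error is kept relative to `exp(Z_g)`, so that after integration it is a multiple of the
exponential moment, which is bounded uniformly in `ε`. -/
theorem abs_exp_sub_exp_le (h : WeaklyDependent P ε K W θ) {d g r : ℝ}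
    (hd : |r - g| ≤ d) (s : S) :
    |Real.exp (scaledPrimitive ε W r s) - Real.exp (scaledPrimitive ε W g s)| ≤
      Real.exp (scaledPrimitive ε W g s) * (Real.exp ((√ε)⁻¹ * (K * d)) - 1) := by
  have h1 : Real.exp (scaledPrimitive ε W r s) - Real.exp (scaledPrimitive ε W g s) =
      Real.exp (scaledPrimitive ε W g s) *
        (Real.exp (scaledPrimitive ε W r s - scaledPrimitive ε W g s) - 1) := by
    rw [mul_sub, ← Real.exp_add, add_sub_cancel, mul_one]
  rw [h1, abs_mul, Real.abs_exp]
  gcongr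
  refine (abs_exp_sub_one_le _).trans ?_
  have hK := h.K_nonneg
  gcongr
  refine (abs_scaledPrimitive_sub_le h.measurable h.bdd g r s).trans ?_
  gcongr

theorem abs_integral_exp_sub_exp_le (h : WeaklyDependent P ε K W θ) {d g r : ℝ}
    (hd : |r - g| ≤ d) {f : S → ℝ} (hf : Measurable f) {C : ℝ}
    (hC : ∀ s, |f s| ≤ C) :
    |∫ s, Real.exp (scaledPrimitive ε W r s) * f s ∂P -
        ∫ s, Real.exp (scaledPrimitive ε W g s) * f s ∂P| ≤
      expMoment P ε W g * (C * (Real.exp ((√ε)⁻¹ * (K * d)) - 1)) := by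
  rw [← integral_sub (integrable_exp_mul h.measurable h.bdd r hf hC)
    (integrable_exp_mul h.measurable h.bdd g hf hC), expMoment, ← integral_mul_const]
  refine abs_integral_le_of_abs_le ((integrable_exp h.measurable h.bdd g).mul_const _)
    (Eventually.of_forall fun s => ?_)
  rw [← sub_mul, abs_mul]
  calc _ ≤ Real.exp (scaledPrimitive ε W g s) * (Real.exp ((√ε)⁻¹ * (K * d)) - 1) * C :=
        mul_le_mul (h.abs_exp_sub_exp_le hd s) (hC s) (abs_nonneg _)
          ((abs_nonneg _).trans (h.abs_exp_sub_exp_le hd s))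
    _ = _ := by ring

/-- The two bounds play different roles: `2 θ u` is integrable in `u`, while `gapError` is uniform
in `u` and becomes small as `ε → 0`. Their minimum can be integrated over all lags by dominated
convergence. -/
theorem abs_integral_exp_sub_mul_le (h : WeaklyDependent P ε K W θ) (hε : 0 < ε)
    (hθ : IntegrableOn θ (Ioi 0)) {L : ℝ} (hL : 0 ≤ L) {t r u : ℝ} (hr : 0 ≤ r) (hrt : r ≤ t)
    (hu : 0 ≤ u) :
    |∫ s, Real.exp (scaledPrimitive ε W r s) * (W r s * W (r + ε * u) s) ∂P -
        expMoment P ε W r * lagCov P ε W r u| ≤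
      Real.exp ((∫ u in Ioi (0 : ℝ), θ u) * t) * min (2 * θ u) (gapError ε K L θ) := by
  have hM0 := (expMoment_pos (P := P) (ε := ε) h.measurable h.bdd r).le
  rw [mul_min_of_nonneg _ _ (Real.exp_pos _).le]
  refine le_min ?_ ?_
  · have h1 := h.abs_integral_exp_le r u hr hu
    have h2 : |expMoment P ε W r * lagCov P ε W r u| ≤ expMoment P ε W r * θ u := by
      rw [abs_mul, abs_of_nonneg hM0]
      exact mul_le_mul_of_nonneg_left (h.abs_lagCov_le r u hr hu) hM0
    have h3 := h.expMoment_le_of_le hε hθ hr hrt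
    have h4 := mul_le_mul_of_nonneg_right h3 (h.theta_nonneg hu)
    refine (abs_sub _ _).trans ?_
    linarith
  -- The exponential is moved back to time `g`, decoupled there from `W r * W (r + ε u)`, and the
  -- mean is moved forward to `r` again. The two moves account for the factor `2` in `gapError`.
  · set g : ℝ := max (r - ε * L) 0 with hg
    have hg0 : 0 ≤ g := le_max_right _ _
    have hgr : g ≤ r := max_le (by nlinarith) hr
    have hd : |r - g| ≤ ε * L := by
      rw [abs_of_nonneg (sub_nonneg.2 hgr)]
      linarith [le_max_left (r - ε * L) 0]
    have h1 := h.abs_integral_exp_sub_exp_le hd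
      (f := fun s => W r s * W (r + ε * u) s)
      ((measurable_apply h.measurable r).mul (measurable_apply h.measurable _))
      (mul_lag_le h.bdd r (r + ε * u))
    have h2 := h.abs_integral_exp_sub_exp_le hd (f := fun _ => 1) measurable_const
      (C := 1) (by simp)
    simp only [mul_one, one_mul] at h2
    change |expMoment P ε W r - expMoment P ε W g| ≤ _ at h2
    have h3 : |∫ s, Real.exp (scaledPrimitive ε W g s) * (W r s * W (r + ε * u) s) ∂P
        - expMoment P ε W g * lagCov P ε W r u| ≤ θ L * expMoment P ε W g := by
      rcases le_total (ε * L) r with hl | hl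
      · have hgl : g = r - ε * L := max_eq_left (sub_nonneg.2 hl)
        have h3 := h.abs_integral_exp_sub_le g r u hg0 hgr hu
        rwa [hgl, sub_sub_cancel, mul_div_cancel_left₀ _ hε.ne', ← hgl] at h3
      -- There is no room for a full gap, but `Z_0 = 0` is deterministic and decoupling is exact.
      · have hgl : g = 0 := max_eq_right (sub_nonpos.2 hl)
        rw [hgl]
        simpa [lagCov] using h.theta_nonneg hL
    set e := Real.exp ((√ε)⁻¹ * (K * (ε * L))) - 1
    set R := lagCov P ε W r u
    have h4 : |(expMoment P ε W g - expMoment P ε W r) * R| ≤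
        expMoment P ε W g * e * (K * K) := by
      rw [abs_mul, abs_sub_comm]
      exact mul_le_mul h2 (h.abs_lagCov_le_sq r u) (abs_nonneg _) ((abs_nonneg _).trans h2)
    set X := ∫ s, Real.exp (scaledPrimitive ε W r s) * (W r s * W (r + ε * u) s) ∂P
    set Y := ∫ s, Real.exp (scaledPrimitive ε W g s) * (W r s * W (r + ε * u) s) ∂P
    have h5 : X - expMoment P ε W r * R = (X - Y) + (Y - expMoment P ε W g * R) +
        (expMoment P ε W g - expMoment P ε W r) * R := by ring
    have hgap := h.gapError_nonneg hε hL
    calc _ ≤ |X - Y| + |Y - expMoment P ε W g * R| +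
          |(expMoment P ε W g - expMoment P ε W r) * R| := by
          rw [h5]; exact abs_add_three _ _ _
      _ ≤ expMoment P ε W g * gapError ε K L θ := by
          have : expMoment P ε W g * gapError ε K L θ = expMoment P ε W g * (K * K * e) +
            θ L * expMoment P ε W g + expMoment P ε W g * e * (K * K) := by
            unfold gapError; ring
          rw [this]
          gcongr
      _ ≤ _ := mul_le_mul_of_nonneg_right (h.expMoment_le_of_le hε hθ hg0 (hgr.trans hrt)) hgap

/-- The total error in the comparison of `expMoment` with the exponential of the variance. -/
noncomputable def comparisonError (ε K L t : ℝ) (θ : ℝ → ℝ) : ℝ :=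
  t * (∫ u in Ioi (0 : ℝ), min (2 * θ u) (gapError ε K L θ)) +
    ∫ r in (0 : ℝ)..t, ∫ u in Ioi (r / ε), θ u

theorem integrableOn_min (h : WeaklyDependent P ε K W θ) (hε : 0 < ε)
    (hθ : IntegrableOn θ (Ioi 0)) {L : ℝ} (hL : 0 ≤ L) :
    IntegrableOn (fun u => min (2 * θ u) (gapError ε K L θ)) (Ioi 0) := by
  refine Integrable.mono' (hθ.const_mul 2)
    ((hθ.const_mul 2).aestronglyMeasurable.inf aestronglyMeasurable_const) ?_
  filter_upwards [ae_restrict_mem measurableSet_Ioi] with u hu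
  have := h.theta_nonneg (le_of_lt hu)
  rw [Real.norm_eq_abs, abs_of_nonneg (le_min (by positivity) (h.gapError_nonneg hε hL))]
  exact min_le_left _ _

/-- The lags up to `(τ - r) / ε` are decoupled. The longer ones occur in `lagRate` but not in the
expansion, and they cost a tail of `θ`, which matters only when `τ - r` is of order `ε`. -/
theorem abs_expansionIntegrand_sub_le (h : WeaklyDependent P ε K W θ) (hε : 0 < ε)
    (hθ : IntegrableOn θ (Ioi 0)) {L : ℝ} (hL : 0 ≤ L) {t τ r : ℝ} (hr : 0 ≤ r) (hrτ : r ≤ τ)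
    (hτ : τ ≤ t) :
    |expansionIntegrand P ε W τ r - expMoment P ε W r * lagRate P ε W r| ≤
      Real.exp ((∫ u in Ioi (0 : ℝ), θ u) * t) *
        ((∫ u in Ioi (0 : ℝ), min (2 * θ u) (gapError ε K L θ)) +
          ∫ u in Ioi ((τ - r) / ε), θ u) := by
  have hx : 0 ≤ (τ - r) / ε := div_nonneg (sub_nonneg.2 hrτ) hε.le
  set x := (τ - r) / ε
  have hR := h.integrableOn_lagCov hθ hr
  have hRI : IntegrableOn (lagCov P ε W r) (Ioc 0 x) := hR.mono_set Ioc_subset_Ioi_self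
  have hRx : IntegrableOn (lagCov P ε W r) (Ioi x) := hR.mono_set (Ioi_subset_Ioi hx)
  have hsplit : lagRate P ε W r = (∫ u in (0 : ℝ)..x, lagCov P ε W r u) +
      ∫ u in Ioi x, lagCov P ε W r u := by
    rw [lagRate, intervalIntegral.integral_of_le hx, ← setIntegral_union (t := Ioi x)
      (Set.disjoint_left.2 fun u hu hu' => (not_lt.2 hu.2) hu') measurableSet_Ioi hRI hRx,
      Ioc_union_Ioi_eq_Ioi hx]
  have hm : StronglyMeasurable fun u : ℝ =>
      ∫ s, Real.exp (scaledPrimitive ε W r s) * (W r s * W (r + ε * u) s) ∂P := by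
    have h1 := (measurable_scaledPrimitive_apply (ε := ε) h.measurable h.bdd r).comp
      (measurable_snd : Measurable (Prod.snd : ℝ × S → S))
    have h2 := (measurable_apply h.measurable r).comp
      (measurable_snd : Measurable (Prod.snd : ℝ × S → S))
    have h3 : Measurable fun p : ℝ × S => W (r + ε * p.1) p.2 :=
      h.measurable.comp (Measurable.prodMk (by fun_prop) measurable_snd)
    exact (h1.exp.mul (h2.mul h3)).stronglyMeasurable.integral_prod_right
  have hEI : IntervalIntegrable (fun u : ℝ =>
      ∫ s, Real.exp (scaledPrimitive ε W r s) * (W r s * W (r + ε * u) s) ∂P) volume 0 x := by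
    rw [intervalIntegrable_iff_integrableOn_Ioc_of_le hx]
    have h1 : IntegrableOn (fun u => θ u * expMoment P ε W r) (Ioc 0 x) :=
      IntegrableOn.mono_set (hθ.mul_const _) Ioc_subset_Ioi_self
    refine Integrable.mono' h1 hm.aestronglyMeasurable ?_
    filter_upwards [ae_restrict_mem measurableSet_Ioc] with u hu
    exact h.abs_integral_exp_le r u hr hu.1.le
  have hmin := h.integrableOn_min hε hθ hL
  set E := Real.exp ((∫ u in Ioi (0 : ℝ), θ u) * t)
  have h1 : |∫ u in (0 : ℝ)..x,
      ((∫ s, Real.exp (scaledPrimitive ε W r s) * (W r s * W (r + ε * u) s) ∂P) -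
        expMoment P ε W r * lagCov P ε W r u)| ≤
      E * ∫ u in Ioi (0 : ℝ), min (2 * θ u) (gapError ε K L θ) := by
    have h2 : IntegrableOn (fun u => E * min (2 * θ u) (gapError ε K L θ)) (Ioc 0 x) :=
      IntegrableOn.mono_set (hmin.const_mul _) Ioc_subset_Ioi_self
    refine (abs_intervalIntegral_le_of_abs_le hx
      (g := fun u => E * min (2 * θ u) (gapError ε K L θ))
      (fun u hu => h.abs_integral_exp_sub_mul_le hε hθ hL hr (hrτ.trans hτ) hu.1.le)
      ((intervalIntegrable_iff_integrableOn_Ioc_of_le hx).2 h2)).trans ?_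
    rw [intervalIntegral.integral_of_le hx, ← integral_const_mul]
    refine setIntegral_mono_set (hmin.const_mul _) ?_ Ioc_subset_Ioi_self.eventuallyLE
    filter_upwards [ae_restrict_mem measurableSet_Ioi] with u hu
    exact mul_nonneg (Real.exp_pos _).le (le_min
      (mul_nonneg zero_le_two (h.theta_nonneg (le_of_lt hu))) (h.gapError_nonneg hε hL))
  have h2 : |expMoment P ε W r * ∫ u in Ioi x, lagCov P ε W r u| ≤
      E * ∫ u in Ioi x, θ u := by
    rw [abs_mul, abs_of_nonneg (expMoment_pos h.measurable h.bdd r).le]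
    refine mul_le_mul (h.expMoment_le_of_le hε hθ hr (hrτ.trans hτ)) ?_ (abs_nonneg _)
      (Real.exp_pos _).le
    refine abs_integral_le_of_abs_le (hθ.mono_set (Ioi_subset_Ioi hx)) ?_
    filter_upwards [ae_restrict_mem measurableSet_Ioi] with u hu
    exact h.abs_lagCov_le r u hr (hx.trans (le_of_lt hu))
  rw [intervalIntegral.integral_sub hEI
    (((intervalIntegrable_iff_integrableOn_Ioc_of_le hx).2 hRI).const_mul _),
    intervalIntegral.integral_const_mul] at h1
  rw [expansionIntegrand_eq h.measurable h.bdd hε hrτ, hsplit, mul_add, mul_add, ← sub_sub]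
  exact (abs_sub _ _).trans (add_le_add h1 h2)

/-- This is the integrated form of the approximate equation `M' = k M`. The reflection `r ↦ τ - r`
brings the tail term into the form used in `comparisonError`. -/
theorem abs_expMoment_sub_le (h : WeaklyDependent P ε K W θ) (hε : 0 < ε)
    (hθ : IntegrableOn θ (Ioi 0)) {L : ℝ} (hL : 0 ≤ L) {t τ : ℝ} (hτ0 : 0 ≤ τ) (hτ : τ ≤ t) :
    |expMoment P ε W τ - 1 - ∫ r in (0 : ℝ)..τ, expMoment P ε W r * lagRate P ε W r| ≤
      Real.exp ((∫ u in Ioi (0 : ℝ), θ u) * t) * comparisonError ε K L t θ := by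
  have hcont : Continuous (expMoment P ε W) := continuous_expMoment h.measurable h.bdd
  have hMk : IntervalIntegrable (fun r => expMoment P ε W r * lagRate P ε W r) volume 0 τ :=
    (h.intervalIntegrable_lagRate hθ hτ0).continuousOn_mul hcont.continuousOn
  set E := Real.exp ((∫ u in Ioi (0 : ℝ), θ u) * t)
  set I := ∫ u in Ioi (0 : ℝ), min (2 * θ u) (gapError ε K L θ)
  have hI0 : 0 ≤ I := setIntegral_nonneg measurableSet_Ioi fun u hu =>
    le_min (mul_nonneg zero_le_two (h.theta_nonneg (le_of_lt hu))) (h.gapError_nonneg hε hL)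
  have htail := intervalIntegrable_tail (fun _ => h.theta_nonneg) hε hθ hτ0
  have htail' : IntervalIntegrable (fun r => ∫ u in Ioi ((τ - r) / ε), θ u) volume 0 τ := by
    have := htail.comp_sub_left τ
    simpa using this.symm
  rw [expMoment_eq h.measurable h.bdd h.centered hτ0, add_sub_cancel_left,
    ← intervalIntegral.integral_sub
      (intervalIntegrable_expansionIntegrand h.measurable h.bdd hτ0) hMk]
  refine (abs_intervalIntegral_le_of_abs_le hτ0
    (g := fun r => E * (I + ∫ u in Ioi ((τ - r) / ε), θ u))
    (fun r hr =>
      h.abs_expansionIntegrand_sub_le hε hθ hL hr.1.le hr.2 hτ)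
    ((intervalIntegrable_const.add htail').const_mul E)).trans ?_
  rw [intervalIntegral.integral_const_mul, intervalIntegral.integral_add intervalIntegrable_const
    htail', intervalIntegral.integral_const, comparisonError,
    intervalIntegral.integral_comp_sub_left (fun r => ∫ u in Ioi (r / ε), θ u), sub_self, sub_zero,
    smul_eq_mul]
  have htt := intervalIntegrable_tail (fun _ => h.theta_nonneg) hε hθ (hτ0.trans hτ)
  have hmono : ∫ r in (0 : ℝ)..τ, ∫ u in Ioi (r / ε), θ u ≤
      ∫ r in (0 : ℝ)..t, ∫ u in Ioi (r / ε), θ u := by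
    refine intervalIntegral.integral_mono_interval le_rfl hτ0 hτ ?_ htt
    filter_upwards [ae_restrict_mem measurableSet_Ioc] with r hr
    exact setIntegral_nonneg measurableSet_Ioi fun u hu =>
      h.theta_nonneg ((div_nonneg hr.1.le hε.le).trans (le_of_lt hu))
  gcongr

/-- The exponential moment of a weakly dependent process is close to the exponential of half of
its variance. -/
theorem abs_expMoment_sub_exp_le (h : WeaklyDependent P ε K W θ) (hε : 0 < ε)
    (hθ : IntegrableOn θ (Ioi 0)) {L : ℝ} (hL : 0 ≤ L) {t : ℝ} (ht : 0 ≤ t) :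
    |expMoment P ε W t - Real.exp (∫ r in (0 : ℝ)..t, lagRate P ε W r)| ≤
      Real.exp (2 * (∫ u in Ioi (0 : ℝ), θ u) * t) * comparisonError ε K L t θ := by
  have hcont : Continuous (expMoment P ε W) := continuous_expMoment h.measurable h.bdd
  set C := ∫ u in Ioi (0 : ℝ), θ u
  set N : ℝ → ℝ := fun τ => Real.exp (∫ r in (0 : ℝ)..τ, lagRate P ε W r)
  have hkt := h.intervalIntegrable_lagRate hθ ht
  have hNcont : ContinuousOn N (Icc 0 t) := by
    have := intervalIntegral.continuousOn_primitive_interval' hkt (a := 0) (by simp)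
    rw [uIcc_of_le ht] at this
    exact this.rexp
  have key := le_mul_exp_of_le_add_integral (f := fun τ => |expMoment P ε W τ - N τ|) (t := t)
    (A := Real.exp (C * t) * comparisonError ε K L t θ) (C := C)
    ((hcont.continuousOn.sub hNcont).abs) h.integral_theta_nonneg ?_ t ⟨ht, le_rfl⟩
  -- One factor `exp(C t)` comes from the bound on the moments, the other from Grönwall.
  · refine key.trans (le_of_eq ?_)
    rw [mul_right_comm, ← Real.exp_add]
    congr 2; ring
  -- `N` solves `N = 1 + ∫ k N` exactly and `expMoment` solves it up to the comparison error. Since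
  -- `|k| ≤ C`, their difference satisfies a Grönwall inequality.
  intro τ hτ
  have hk := h.intervalIntegrable_lagRate hθ hτ.1
  have hNτ : ContinuousOn N (uIcc 0 τ) := by
    rw [uIcc_of_le hτ.1]; exact hNcont.mono (Icc_subset_Icc_right hτ.2)
  have h1 : N τ = 1 + ∫ r in (0 : ℝ)..τ, lagRate P ε W r * N r := exp_integral_eq hk
  have hi1 : IntervalIntegrable (fun r => expMoment P ε W r * lagRate P ε W r) volume 0 τ :=
    hk.continuousOn_mul hcont.continuousOn
  have hi2 : IntervalIntegrable (fun r => lagRate P ε W r * N r) volume 0 τ :=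
    hk.mul_continuousOn hNτ
  have h2 : expMoment P ε W τ - N τ = (expMoment P ε W τ - 1 -
      ∫ r in (0 : ℝ)..τ, expMoment P ε W r * lagRate P ε W r) +
      ∫ r in (0 : ℝ)..τ, (expMoment P ε W r * lagRate P ε W r - lagRate P ε W r * N r) := by
    rw [intervalIntegral.integral_sub hi1 hi2, h1]; ring
  have h3 : |∫ r in (0 : ℝ)..τ,
      (expMoment P ε W r * lagRate P ε W r - lagRate P ε W r * N r)| ≤
      C * ∫ r in (0 : ℝ)..τ, |expMoment P ε W r - N r| := by
    rw [← intervalIntegral.integral_const_mul]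
    refine abs_intervalIntegral_le_of_abs_le hτ.1 (fun r hr => ?_) ?_
    · rw [mul_comm (lagRate P ε W r), ← sub_mul, abs_mul, mul_comm]
      exact mul_le_mul_of_nonneg_right (h.abs_lagRate_le hθ hr.1.le) (abs_nonneg _)
    · exact (((hcont.continuousOn.sub hNτ).abs).intervalIntegrable).const_mul C
  rw [h2]
  exact (abs_add_le _ _).trans (add_le_add (h.abs_expMoment_sub_le hε hθ hL hτ.1 hτ.2) h3)

end WeaklyDependent

end Comparison

/-! ### Uniform mixing and the field along a path -/

section Mixing

variable {S : Type*}

theorem measurable_sigmaField {c : ℝ≥0 → ℝ → S → ℝ} {A : Set (ℝ≥0 × ℝ)} {t : ℝ≥0} {x : ℝ}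
    (h : (t, x) ∈ A) : Measurable[sigmaField c A] (c t x) := by
  rw [measurable_iff_comap_le]
  exact le_iSup₂ (f := fun (p : ℝ≥0 × ℝ) (_ : p ∈ A) =>
    MeasurableSpace.comap (c p.1 p.2) inferInstance) (t, x) h

variable {m m₁ m₂ : MeasurableSpace S} [mS : MeasurableSpace S] {P : Measure S}
  [IsProbabilityMeasure P]

/-- Layer-cake argument: `h + H` takes values in `[0, 2H]`, and each of its superlevel sets
contributes a mixing defect of at most `φ * P.real D`. Integrating over the levels gives the factor
`2H`. -/
theorem abs_setIntegral_sub_le (hm : m ≤ mS) {D : Set S}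
    (hD : MeasurableSet D) {φ : ℝ}
    (hmix : ∀ A, MeasurableSet[m] A → |P.real (A ∩ D) - P.real A * P.real D| ≤ φ * P.real D)
    {h : S → ℝ} {H : ℝ} (hh : Measurable[m] h) (hH : ∀ s, |h s| ≤ H) :
    |∫ s in D, h s ∂P - (∫ s, h s ∂P) * P.real D| ≤ 2 * H * φ * P.real D := by
  have hh' : Measurable h := hh.mono hm le_rfl
  have hint : Integrable h P := Integrable.of_bound hh'.aestronglyMeasurable H
    (Eventually.of_forall hH)
  have hH0 : 0 ≤ H := by
    obtain ⟨s⟩ := nonempty_of_isProbabilityMeasure P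
    exact (abs_nonneg _).trans (hH s)
  have hlayer : ∀ μ : Measure S, IsFiniteMeasure μ → Integrable h μ →
      ∫ s, h s ∂μ + H * μ.real univ = ∫ t in Ioc 0 (2 * H), μ.real {s | t ≤ h s + H} := by
    intro μ _ hμ
    rw [← Integrable.integral_eq_integral_Ioc_meas_le (f := fun s => h s + H)
      (hμ.add (integrable_const _))
      (Eventually.of_forall fun s => by
        have := neg_abs_le (h s); have := hH s; change 0 ≤ h s + H; linarith)
      (Eventually.of_forall fun s => by
        have := le_abs_self (h s); have := hH s; change h s + H ≤ 2 * H; linarith),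
      integral_add hμ (integrable_const _)]
    simp [mul_comm]
  have hmeas : ∀ μ : Measure S, IsFiniteMeasure μ →
      IntegrableOn (fun t => μ.real {s | t ≤ h s + H}) (Ioc 0 (2 * H)) := by
    intro μ _
    have hanti : Antitone fun t => μ.real {s | t ≤ h s + H} := fun a b hab =>
      measureReal_mono fun s (hs : b ≤ h s + H) => hab.trans hs
    exact ((hanti.antitoneOn (uIcc 0 (2 * H))).intervalIntegrable.1)
  have h1 := hlayer P inferInstance hint
  have h2 := hlayer (P.restrict D) inferInstance hint.restrict
  have h3 : ∫ s in D, h s ∂P - (∫ s, h s ∂P) * P.real D =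
      ∫ t in Ioc 0 (2 * H), ((P.restrict D).real {s | t ≤ h s + H} -
        P.real {s | t ≤ h s + H} * P.real D) := by
    rw [integral_sub (hmeas _ inferInstance) ((hmeas P inferInstance).mul_const _),
      integral_mul_const, ← h1, ← h2]
    simp
    ring
  rw [h3]
  have h4 : ∀ t ∈ Ioc 0 (2 * H), ‖(P.restrict D).real {s | t ≤ h s + H} -
      P.real {s | t ≤ h s + H} * P.real D‖ ≤ φ * P.real D := by
    intro t _
    rw [measureReal_restrict_apply' hD]
    exact hmix _ (measurableSet_le measurable_const (hh.add_const H))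
  have h5 := norm_setIntegral_le_of_norm_le_const (μ := (volume : Measure ℝ))
    measure_Ioc_lt_top h4
  refine h5.trans (le_of_eq ?_)
  rw [Real.volume_real_Ioc_of_le (by linarith)]
  ring

/-- The covariance inequality for uniformly mixing σ-algebras. -/
theorem abs_integral_mul_sub_le (hm₁ : m₁ ≤ mS) (hm₂ : m₂ ≤ mS)
    {φ : ℝ}
    (hmix : ∀ A D, MeasurableSet[m₁] A → MeasurableSet[m₂] D →
      |P.real (A ∩ D) - P.real A * P.real D| ≤ φ * P.real D)
    {f h : S → ℝ} {H : ℝ} (hf : AEStronglyMeasurable[m₂] f P) (hfi : Integrable f P)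
    (hh : Measurable[m₁] h) (hH : ∀ s, |h s| ≤ H) :
    |∫ s, f s * h s ∂P - (∫ s, f s ∂P) * ∫ s, h s ∂P| ≤ 2 * H * φ * ∫ s, |f s| ∂P := by
  have hh' : Measurable h := hh.mono hm₁ le_rfl
  have hint : Integrable h P := Integrable.of_bound hh'.aestronglyMeasurable H
    (Eventually.of_forall hH)
  set e := ∫ s, h s ∂P
  set h0 : S → ℝ := fun s => h s - e with hh0
  have h0int : Integrable h0 P := hint.sub (integrable_const _)
  -- A bound proportional to `P.real D` on every `D` in `m₂` forces the conditional expectation of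
  -- `h0` to lie in `[-2Hφ, 2Hφ]` almost surely. This `L^∞` bound is what allows `f` to be merely
  -- integrable.
  have hbound : ∀ D, MeasurableSet[m₂] D → |∫ s in D, (P[h0 | m₂]) s ∂P| ≤
      2 * H * φ * P.real D := by
    intro D hD
    rw [setIntegral_condExp hm₂ h0int hD]
    have h1 := abs_setIntegral_sub_le hm₁ (hm₂ D hD) (fun A hA => hmix A D hA hD) hh hH
    rwa [hh0, integral_sub hint.restrict (integrable_const _), setIntegral_const, smul_eq_mul,
      mul_comm (P.real D)]
  have hcm : StronglyMeasurable[m₂] (P[h0 | m₂]) := stronglyMeasurable_condExp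
  have hci : Integrable (P[h0 | m₂]) (P.trim hm₂) := integrable_condExp.trim hm₂ hcm
  have hset : ∀ D, MeasurableSet[m₂] D → ∫ s in D, (P[h0 | m₂]) s ∂(P.trim hm₂) =
      ∫ s in D, (P[h0 | m₂]) s ∂P := fun D hD => (setIntegral_trim hm₂ hcm hD).symm
  have hconst : ∀ D, MeasurableSet[m₂] D → ∀ C : ℝ, ∫ _ in D, C ∂(P.trim hm₂) =
      C * P.real D := by
    intro D hD C
    rw [setIntegral_const, smul_eq_mul, mul_comm, Measure.real, trim_measurableSet_eq hm₂ hD]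
    rfl
  have hub : P[h0 | m₂] ≤ᵐ[P.trim hm₂] fun _ => 2 * H * φ := by
    refine ae_le_of_forall_setIntegral_le hci (integrable_const _) fun D hD _ => ?_
    rw [hset D hD, hconst D hD]
    exact (le_abs_self _).trans (hbound D hD)
  have hlb : (fun _ => -(2 * H * φ)) ≤ᵐ[P.trim hm₂] P[h0 | m₂] := by
    refine ae_le_of_forall_setIntegral_le (integrable_const _) hci fun D hD _ => ?_
    rw [hset D hD, hconst D hD]
    have := neg_abs_le (∫ s in D, (P[h0 | m₂]) s ∂P)
    have := hbound D hD
    linarith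
  have hfh0 : Integrable (f * h0) P := by
    have : Integrable (fun s => h0 s * f s) P := hfi.bdd_mul (c := H + |e|)
      (hh'.sub_const e).aestronglyMeasurable
      (Eventually.of_forall fun s => (abs_sub _ _).trans (by gcongr; exact hH s))
    exact this.congr (Eventually.of_forall fun s => mul_comm _ _)
  have hfh : Integrable (fun s => f s * h s) P := by
    have : Integrable (fun s => h s * f s) P := hfi.bdd_mul (c := H)
      hh'.aestronglyMeasurable (Eventually.of_forall hH)
    exact this.congr (Eventually.of_forall fun s => mul_comm _ _)
  have h1 : ∫ s, f s * h s ∂P - (∫ s, f s ∂P) * e = ∫ s, f s * (P[h0 | m₂]) s ∂P := by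
    have h2 : ∫ s, (f * h0) s ∂P = ∫ s, f s * h s ∂P - (∫ s, f s ∂P) * e := by
      rw [← integral_mul_const, ← integral_sub hfh (hfi.mul_const e)]
      exact integral_congr_ae (Eventually.of_forall fun s => mul_sub _ _ _)
    rw [← h2, ← integral_condExp hm₂]
    exact integral_congr_ae (condExp_mul_of_aestronglyMeasurable_left hf hfh0 h0int)
  rw [h1, ← integral_const_mul]
  refine abs_integral_le_of_abs_le (hfi.abs.const_mul _) ?_
  filter_upwards [ae_of_ae_trim hm₂ hub, ae_of_ae_trim hm₂ hlb] with s hs1 hs2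
  rw [abs_mul, mul_comm]
  exact mul_le_mul_of_nonneg_right (abs_le.2 ⟨hs2, hs1⟩) (abs_nonneg _)

/-- The integral over time of a jointly measurable process is almost surely measurable with
respect to every σ-algebra for which the process is measurable at each time. -/
theorem aestronglyMeasurable_intervalIntegral (hm : m ≤ mS)
    {W : ℝ → S → ℝ} (hW : Measurable (Function.uncurry W)) {K : ℝ} (hK : ∀ r s, |W r s| ≤ K)
    {r : ℝ} (hr : 0 ≤ r) (hmeas : ∀ a ∈ Ioc 0 r, Measurable[m] (W a)) :
    AEStronglyMeasurable[m] (fun s => ∫ a in (0 : ℝ)..r, W a s) P := by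
  set Z : S → ℝ := fun s => ∫ a in (0 : ℝ)..r, W a s with hZ
  have hZm : Measurable Z := by
    have h1 := measurable_scaledPrimitive_apply (ε := 1) hW hK r
    have h2 : scaledPrimitive 1 W r = Z := by funext s; simp [scaledPrimitive, hZ]
    rwa [h2] at h1
  have hZb : ∀ s, |Z s| ≤ K * |r| := by
    intro s
    have := abs_scaledPrimitive_le (ε := 1) hW hK r s
    simpa [scaledPrimitive] using this
  have hZi : Integrable Z P := Integrable.of_bound hZm.aestronglyMeasurable _
    (Eventually.of_forall hZb)
  set Y := P[Z | m]
  have hYm : StronglyMeasurable[m] Y := stronglyMeasurable_condExp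
  have hYi : Integrable Y P := integrable_condExp
  have hYb : ∀ᵐ s ∂P, |Y s| ≤ K * |r| :=
    ae_bdd_abs_condExp_of_ae_bdd_abs (Eventually.of_forall hZb)
  -- `Z - Y` is orthogonal to bounded `m`-measurable variables, in particular to each `W a`. By
  -- Fubini it is then orthogonal to `Z` as well as to `Y`, so `E (Z - Y)² = 0`.
  have horth : ∀ g : S → ℝ, AEStronglyMeasurable[m] g P → (∃ C, ∀ᵐ s ∂P, |g s| ≤ C) →
      ∫ s, g s * (Z s - Y s) ∂P = 0 := by
    rintro g hg ⟨C, hC⟩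
    have hgZ : Integrable (g * Z) P := hZi.bdd_mul (hg.mono hm) hC
    have hgY : Integrable (g * Y) P := hYi.bdd_mul (hg.mono hm) hC
    have h1 : ∫ s, (g * Z) s ∂P = ∫ s, (g * Y) s ∂P := by
      rw [← integral_condExp hm]
      exact integral_congr_ae (condExp_mul_of_aestronglyMeasurable_left hg hgZ hZi)
    have h2 : ∀ s, g s * (Z s - Y s) = (g * Z) s - (g * Y) s := fun s => mul_sub _ _ _
    simp only [h2]
    rw [integral_sub hgZ hgY, h1, sub_self]
  have hZY : ∫ s, Z s * (Z s - Y s) ∂P = 0 := by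
    have h1 : ∀ s, Z s * (Z s - Y s) = ∫ a in Ioc 0 r, W a s * (Z s - Y s) := by
      intro s
      rw [integral_mul_const, ← intervalIntegral.integral_of_le hr]
    simp only [h1]
    rw [integral_integral_swap (f := fun s a => W a s * (Z s - Y s))]
    · rw [setIntegral_congr_fun measurableSet_Ioc (g := fun _ => (0 : ℝ))]
      · simp
      · intro a ha
        exact horth _ (hmeas a ha).stronglyMeasurable.aestronglyMeasurable
          ⟨K, Eventually.of_forall (hK a)⟩
    · have hd : Integrable (fun p : S × ℝ => Z p.1 - Y p.1)
          (P.prod (volume.restrict (Ioc 0 r))) := (hZi.sub hYi).comp_fst _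
      exact hd.bdd_mul (c := K) (hW.comp measurable_swap).aestronglyMeasurable
        (Eventually.of_forall fun p => hK p.2 p.1)
  have hYY := horth Y hYm.aestronglyMeasurable ⟨_, hYb⟩
  have hdi : Integrable (fun s => Z s - Y s) P := hZi.sub hYi
  have hi1 : Integrable (fun s => Z s * (Z s - Y s)) P :=
    hdi.bdd_mul hZm.aestronglyMeasurable (Eventually.of_forall hZb)
  have hi2 : Integrable (fun s => Y s * (Z s - Y s)) P :=
    hdi.bdd_mul hYi.aestronglyMeasurable hYb
  have hsq : ∫ s, (Z s - Y s) ^ 2 ∂P = 0 := by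
    have : ∀ s, (Z s - Y s) ^ 2 = Z s * (Z s - Y s) - Y s * (Z s - Y s) := fun s => by ring
    simp only [this]
    rw [integral_sub hi1 hi2, hZY, hYY, sub_self]
  have hsqi : Integrable (fun s => (Z s - Y s) ^ 2) P :=
    (hi1.sub hi2).congr (Eventually.of_forall fun s => by simp only [Pi.sub_apply]; ring)
  have h0 := (integral_eq_zero_iff_of_nonneg (fun s => sq_nonneg _) hsqi).1 hsq
  refine ⟨Y, hYm, ?_⟩
  filter_upwards [h0] with s hs
  simpa [sub_eq_zero] using hs

variable {c : ℝ≥0 → ℝ → S → ℝ}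

theorem measurable_field_apply (hc : Measurable fun p : (ℝ≥0 × ℝ) × S => c p.1.1 p.1.2 p.2)
    (t : ℝ≥0) (x : ℝ) : Measurable (c t x) :=
  hc.comp (measurable_prodMk_left (x := (t, x)))

theorem sigmaField_le (hc : Measurable fun p : (ℝ≥0 × ℝ) × S => c p.1.1 p.1.2 p.2)
    (A : Set (ℝ≥0 × ℝ)) : sigmaField c A ≤ mS :=
  iSup₂_le fun p _ => (measurable_field_apply hc p.1 p.2).comap_le

theorem alphaUm_nonneg (r : ℝ) : 0 ≤ alphaUm P c r :=
  le_csSup (bddAbove_mixingDefects P c r) (zero_mem_mixingDefects P c r)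

theorem abs_measureReal_inter_sub_le
    (hc : Measurable fun p : (ℝ≥0 × ℝ) × S => c p.1.1 p.1.2 p.2)
    {A₁ A₂ : Set (ℝ≥0 × ℝ)} {r : ℝ} (hA : FarApart A₁ A₂ r) {A D : Set S}
    (hA' : MeasurableSet[sigmaField c A₁] A) (hD : MeasurableSet[sigmaField c A₂] D) :
    |P.real (A ∩ D) - P.real A * P.real D| ≤ alphaUm P c r * P.real D := by
  by_cases h0 : P D = 0
  · have h1 : P.real D = 0 := by simp [Measure.real, h0]
    have h2 : P.real (A ∩ D) = 0 := by
      simp [Measure.real, measure_mono_null inter_subset_right h0]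
    simp [h1, h2]
  · have hle : |(cond P D).real A - P.real A| ≤ alphaUm P c r :=
      le_csSup (bddAbove_mixingDefects P c r) ⟨A₁, A₂, hA, A, D, hA', hD, h0, rfl⟩
    have hpos : 0 < P.real D := ENNReal.toReal_pos h0 (measure_ne_top _ _)
    have hcond : (cond P D).real A = (P.real D)⁻¹ * P.real (A ∩ D) := by
      rw [inter_comm, Measure.real, cond_apply (sigmaField_le hc A₂ D hD), ENNReal.toReal_mul,
        ENNReal.toReal_inv]
      rfl
    have h1 : P.real (A ∩ D) - P.real A * P.real D =
        ((cond P D).real A - P.real A) * P.real D := by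
      rw [hcond]; field_simp
    rw [h1, abs_mul, abs_of_pos hpos]
    exact mul_le_mul_of_nonneg_right hle hpos.le

theorem abs_integral_mul_sub_le_alphaUm
    (hc : Measurable fun p : (ℝ≥0 × ℝ) × S => c p.1.1 p.1.2 p.2)
    {A₁ A₂ : Set (ℝ≥0 × ℝ)} {r : ℝ} (hA : FarApart A₁ A₂ r)
    {f h : S → ℝ} {H : ℝ} (hf : AEStronglyMeasurable[sigmaField c A₂] f P) (hfi : Integrable f P)
    (hh : Measurable[sigmaField c A₁] h) (hH : ∀ s, |h s| ≤ H) :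
    |∫ s, f s * h s ∂P - (∫ s, f s ∂P) * ∫ s, h s ∂P| ≤
      2 * H * alphaUm P c r * ∫ s, |f s| ∂P :=
  abs_integral_mul_sub_le (sigmaField_le hc A₁) (sigmaField_le hc A₂)
    (fun _ _ hA' hD => abs_measureReal_inter_sub_le hc hA hA' hD) hf hfi hh hH

/-- The field seen along a path `X`, with time accelerated by `ε⁻¹`. -/
noncomputable def fieldAlong (c : ℝ≥0 → ℝ → S → ℝ) (ε : ℝ) (X : ℝ → ℝ) (r : ℝ) (s : S) : ℝ :=
  c (r / ε).toNNReal (X r) s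

/-- The range of the space-time path `a ↦ (a / ε, X a)`, `a ∈ I`. -/
def pathRange (ε : ℝ) (X : ℝ → ℝ) (I : Set ℝ) : Set (ℝ≥0 × ℝ) :=
  (fun a => ((a / ε).toNNReal, X a)) '' I

/-- Separation in time alone bounds the Euclidean distance from below, whatever the path does in
space. All mixing estimates are therefore uniform in `X`. -/
theorem farApart_pathRange {ε : ℝ} (hε : 0 < ε) (X : ℝ → ℝ) {I J : Set ℝ} {d : ℝ}
    (hI : ∀ a ∈ I, 0 ≤ a) (hJ : ∀ a ∈ J, 0 ≤ a) (h : ∀ a ∈ I, ∀ b ∈ J, b + ε * d ≤ a) :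
    FarApart (pathRange ε X I) (pathRange ε X J) d := by
  rintro _ ⟨a, ha, rfl⟩ _ ⟨b, hb, rfl⟩
  have h1 : d ≤ a / ε - b / ε := by
    rw [← sub_div, le_div_iff₀ hε]
    linarith [h a ha b hb]
  refine h1.trans ((le_abs_self _).trans ?_)
  rw [← Real.sqrt_sq_eq_abs]
  apply Real.sqrt_le_sqrt
  simp only [Real.coe_toNNReal _ (div_nonneg (hI a ha) hε.le),
    Real.coe_toNNReal _ (div_nonneg (hJ b hb) hε.le)]
  nlinarith [sq_nonneg (X a - X b)]

theorem measurable_fieldAlong (hc : Measurable fun p : (ℝ≥0 × ℝ) × S => c p.1.1 p.1.2 p.2)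
    (ε : ℝ) {X : ℝ → ℝ} (hX : Measurable X) : Measurable (Function.uncurry (fieldAlong c ε X)) := by
  have h1 : Measurable fun q : ℝ × S => (((q.1 / ε).toNNReal, X q.1), q.2) := by fun_prop
  exact hc.comp h1

/-- The field along a path is weakly dependent, uniformly in the path. -/
theorem weaklyDependent_fieldAlong
    (hc : Measurable fun p : (ℝ≥0 × ℝ) × S => c p.1.1 p.1.2 p.2) {K : ℝ}
    (hK : ∀ t x s, |c t x s| ≤ K) (h0 : ∀ t x, ∫ s, c t x s ∂P = 0) {ε : ℝ} (hε : 0 < ε)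
    {X : ℝ → ℝ} (hX : Measurable X) :
    WeaklyDependent P ε K (fieldAlong c ε X) (fun u => 2 * K * K * alphaUm P c u) := by
  have hW := measurable_fieldAlong hc ε hX
  have hWK : ∀ r s, |fieldAlong c ε X r s| ≤ K := fun r s => hK _ _ s
  have hWm : ∀ (I : Set ℝ) (a : ℝ), a ∈ I →
      Measurable[sigmaField c (pathRange ε X I)] (fieldAlong c ε X a) := fun I a ha =>
    measurable_sigmaField (mem_image_of_mem _ ha)
  have hZm : ∀ r, 0 ≤ r → AEStronglyMeasurable[sigmaField c (pathRange ε X (Icc 0 r))]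
      (fun s => Real.exp (scaledPrimitive ε (fieldAlong c ε X) r s)) P := by
    intro r hr
    have h1 := aestronglyMeasurable_intervalIntegral (P := P)
      (sigmaField_le hc (pathRange ε X (Icc 0 r))) hW hWK hr
      (fun a ha => hWm _ a (Ioc_subset_Icc_self ha))
    exact Real.continuous_exp.comp_aestronglyMeasurable (h1.const_mul _)
  have hc0 : ∀ r, ∫ s, fieldAlong c ε X r s ∂P = 0 := fun r => h0 _ _
  -- The value of `W` at `r + ε u` is centred and at distance at least `u` from the past up to `r`,
  -- so only the mixing error survives. It is used below with `f = W_r` and with `f = exp(Z_r) W_r`.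
  have hlag : ∀ r u, 0 ≤ r → 0 ≤ u → ∀ f : S → ℝ,
      AEStronglyMeasurable[sigmaField c (pathRange ε X (Icc 0 r))] f P → Integrable f P →
      |∫ s, f s * fieldAlong c ε X (r + ε * u) s ∂P| ≤
        2 * K * alphaUm P c u * ∫ s, |f s| ∂P := by
    intro r u hr hu f hf hfi
    have hfar : FarApart (pathRange ε X {r + ε * u}) (pathRange ε X (Icc 0 r)) u := by
      refine farApart_pathRange hε X ?_ (fun a ha => ha.1) ?_
      · rintro _ rfl; positivity
      · rintro _ rfl b hb; linarith [hb.2]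
    have h1 := abs_integral_mul_sub_le_alphaUm (P := P) hc hfar hf hfi
      (hWm _ (r + ε * u) (mem_singleton _)) (hWK _)
    rwa [hc0, mul_zero, sub_zero] at h1
  have hK0 : 0 ≤ K := by
    obtain ⟨s⟩ := nonempty_of_isProbabilityMeasure P
    exact (abs_nonneg _).trans (hK 0 0 s)
  refine ⟨hW, hWK, fun r _ => hc0 r, ?_, ?_, ?_⟩
  · intro r u hr hu
    have hi : Integrable (fieldAlong c ε X r) P :=
      Integrable.of_bound (measurable_apply hW r).aestronglyMeasurable K
        (Eventually.of_forall (hWK r))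
    refine (hlag r u hr hu _ (hWm (Icc 0 r) r ⟨hr, le_rfl⟩).stronglyMeasurable.aestronglyMeasurable
      hi).trans ?_
    have h1 : ∫ s, |fieldAlong c ε X r s| ∂P ≤ K :=
      (le_abs_self _).trans (abs_integral_le_of_abs_le_const fun s => by
        rw [abs_abs]; exact hWK r s)
    have := alphaUm_nonneg (P := P) (c := c) u
    calc _ ≤ 2 * K * alphaUm P c u * K := by gcongr
      _ = _ := by ring
  · intro r u hr hu
    have hi := integrable_exp_mul (P := P) (ε := ε) hW hWK r (measurable_apply hW r) (hWK r)
    have h1 := hlag r u hr hu _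
      ((hZm r hr).mul (hWm (Icc 0 r) r ⟨hr, le_rfl⟩).stronglyMeasurable.aestronglyMeasurable) hi
    simp only [Pi.mul_apply, mul_assoc] at h1
    refine h1.trans ?_
    have h2 : ∫ s, |Real.exp (scaledPrimitive ε (fieldAlong c ε X) r s) * fieldAlong c ε X r s| ∂P
        ≤ expMoment P ε (fieldAlong c ε X) r * K := by
      rw [expMoment, ← integral_mul_const]
      refine integral_mono hi.abs ((integrable_exp hW hWK r).mul_const K) fun s => ?_
      simp only [abs_mul, Real.abs_exp]
      gcongr
      exact hWK r s
    have := alphaUm_nonneg (P := P) (c := c) u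
    calc _ ≤ 2 * (K * (alphaUm P c u * (expMoment P ε (fieldAlong c ε X) r * K))) := by gcongr
      _ = _ := by ring
  · intro g r u hg hgr hu
    -- Here the pair of times `r` and `r + ε u` together forms the future, and the gap is measured
    -- from `g`.
    have hfar : FarApart (pathRange ε X {r, r + ε * u}) (pathRange ε X (Icc 0 g))
        ((r - g) / ε) := by
      have hεu : 0 ≤ ε * u := by positivity
      refine farApart_pathRange hε X ?_ (fun a ha => ha.1) ?_
      · rintro a (rfl | rfl) <;> linarith
      · rw [mul_div_cancel₀ _ hε.ne']
        rintro a (rfl | rfl) b hb <;> linarith [hb.2]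
    have hm1 := hWm {r, r + ε * u} r (by simp)
    have hm2 := hWm {r, r + ε * u} (r + ε * u) (by simp)
    have h1 := abs_integral_mul_sub_le_alphaUm (P := P) hc hfar (hZm g hg)
      (integrable_exp hW hWK g) (hm1.mul hm2) (mul_lag_le hWK r (r + ε * u))
    simp only [Real.abs_exp] at h1
    refine h1.trans (le_of_eq ?_)
    rw [expMoment]
    ring

end Mixing

/-! ### Continuity of translations in mean -/

section Translation

theorem tendsto_integral_abs_translate_sub {g : ℝ → ℝ} (hg : Integrable g) :
    Tendsto (fun y => ∫ z, |g (z + y) - g z|) (𝓝 0) (𝓝 0) := by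
  set f : Lp ℝ 1 (volume : Measure ℝ) := hg.toL1 g
  let T : ℝ → C(ℝ, ℝ) := fun y => ⟨fun z => z + y, by fun_prop⟩
  have hT : Tendsto T (𝓝 0) (𝓝 (T 0)) := by
    have : Continuous T :=
      (ContinuousMap.curry ⟨fun p : ℝ × ℝ => p.2 + p.1, by fun_prop⟩).continuous
    exact this.tendsto 0
  have hmp : ∀ y, MeasurePreserving (T y) volume volume := fun y =>
    measurePreserving_add_right volume y
  have h1 : Tendsto (fun y => Lp.compMeasurePreserving (T y) (hmp y) f) (𝓝 0)
      (𝓝 (Lp.compMeasurePreserving (T 0) (hmp 0) f)) :=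
    Filter.Tendsto.compMeasurePreservingLp tendsto_const_nhds hT hmp (hmp 0) ENNReal.one_ne_top
  have hcoe : ∀ y, (Lp.compMeasurePreserving (T y) (hmp y) f : ℝ → ℝ) =ᵐ[volume]
      fun z => g (z + y) := fun y =>
    (Lp.coeFn_compMeasurePreserving f (hmp y)).trans
      ((hmp y).quasiMeasurePreserving.ae_eq_comp hg.coeFn_toL1)
  have h2 := (tendsto_iff_norm_sub_tendsto_zero.1 h1)
  refine h2.congr fun y => ?_
  rw [L1.norm_eq_integral_norm]
  refine integral_congr_ae ?_
  filter_upwards [Lp.coeFn_sub (Lp.compMeasurePreserving (T y) (hmp y) f)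
    (Lp.compMeasurePreserving (T 0) (hmp 0) f), hcoe y, hcoe 0] with z h3 h4 h5
  rw [h3, Pi.sub_apply, h4, h5, add_zero]
  rfl

theorem tendsto_intervalIntegral_abs_translate_sub {g : ℝ → ℝ} (hg : Measurable g) {K : ℝ}
    (hK : ∀ z, |g z| ≤ K) :
    Tendsto (fun y => ∫ z in (0 : ℝ)..1, |g (z + y) - g z|) (𝓝 0) (𝓝 0) := by
  -- The window `[-1, 2]` contains both `z` and `z + y` whenever `z ∈ [0, 1]` and `|y| ≤ 1`.
  set f : ℝ → ℝ := (Icc (-1) 2).indicator g with hf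
  have hfi : Integrable f := (integrable_indicator_iff measurableSet_Icc).2
    (Measure.integrableOn_of_bounded (M := K) (by simp) hg.aestronglyMeasurable
      (Eventually.of_forall hK))
  refine squeeze_zero' (Eventually.of_forall fun y => ?_) ?_
    (tendsto_integral_abs_translate_sub hfi)
  · exact intervalIntegral.integral_nonneg zero_le_one fun z _ => abs_nonneg _
  · filter_upwards [Icc_mem_nhds (a := (-1 : ℝ)) (b := 1) (by norm_num) (by norm_num)] with y hy
    have h1 : ∫ z in (0 : ℝ)..1, |g (z + y) - g z| = ∫ z in (0 : ℝ)..1, |f (z + y) - f z| := by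
      refine intervalIntegral.integral_congr fun z hz => ?_
      rw [uIcc_of_le zero_le_one] at hz
      have h2 : z ∈ Icc (-1 : ℝ) 2 := ⟨by linarith [hz.1], by linarith [hz.2]⟩
      have h3 : z + y ∈ Icc (-1 : ℝ) 2 := ⟨by linarith [hz.1, hy.1], by linarith [hz.2, hy.2]⟩
      simp only [hf, indicator_of_mem h2, indicator_of_mem h3]
    rw [h1, intervalIntegral.integral_of_le zero_le_one]
    exact setIntegral_le_integral ((hfi.comp_add_right y).sub hfi).abs
      (Eventually.of_forall fun z => abs_nonneg _)

end Translation

/-! ### The correlation function: shift invariance, decay and continuity at zero -/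

section Correlation

variable {S : Type*} [MeasurableSpace S] {P : Measure S} {c : ℝ≥0 → ℝ → S → ℝ}

theorem integral_mul_shift_eq_corr (hc : Measurable fun p : (ℝ≥0 × ℝ) × S => c p.1.1 p.1.2 p.2)
    (hstat : Stationary P c) (s t : ℝ≥0) (y x : ℝ) :
    ∫ σ, c s y σ * c (t + s) (x + y) σ ∂P = corr P c t x := by
  have hF : StronglyMeasurable fun f : ℝ≥0 × ℝ → ℝ => f (0, 0) * f (t, x) := by
    refine Measurable.stronglyMeasurable ?_
    fun_prop
  have h1 : Measurable fun (σ : S) (p : ℝ≥0 × ℝ) => c (p.1 + s) (p.2 + y) σ :=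
    measurable_pi_lambda _ fun p => measurable_field_apply hc _ _
  have h2 : Measurable fun (σ : S) (p : ℝ≥0 × ℝ) => c p.1 p.2 σ :=
    measurable_pi_lambda _ fun p => measurable_field_apply hc _ _
  have h3 := integral_map (μ := P) h1.aemeasurable hF.aestronglyMeasurable
  have h4 := integral_map (μ := P) h2.aemeasurable hF.aestronglyMeasurable
  rw [hstat s y, h4] at h3
  simpa [corr] using h3.symm

/-- Along a path, the covariances are given by the correlation function. -/
theorem lagCov_fieldAlong (hc : Measurable fun p : (ℝ≥0 × ℝ) × S => c p.1.1 p.1.2 p.2)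
    (hstat : Stationary P c) {ε : ℝ} (hε : 0 < ε) (X : ℝ → ℝ) {r u : ℝ} (hr : 0 ≤ r)
    (hu : 0 ≤ u) :
    lagCov P ε (fieldAlong c ε X) r u = corr P c u.toNNReal (X (r + ε * u) - X r) := by
  rw [← integral_mul_shift_eq_corr hc hstat (r / ε).toNNReal u.toNNReal (X r)]
  unfold lagCov fieldAlong
  rw [← Real.toNNReal_add hu (div_nonneg hr hε.le), sub_add_cancel]
  have : (r + ε * u) / ε = u + r / ε := by field_simp; ring
  rw [this]

variable [IsProbabilityMeasure P] {K : ℝ}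

theorem measurable_corr (hc : Measurable fun p : (ℝ≥0 × ℝ) × S => c p.1.1 p.1.2 p.2) :
    Measurable (Function.uncurry (corr P c)) := by
  have h1 : Measurable fun p : (ℝ≥0 × ℝ) × S => c 0 0 p.2 * c p.1.1 p.1.2 p.2 :=
    ((measurable_field_apply hc 0 0).comp measurable_snd).mul hc
  exact h1.stronglyMeasurable.integral_prod_right.measurable

theorem measurable_corr_apply (hc : Measurable fun p : (ℝ≥0 × ℝ) × S => c p.1.1 p.1.2 p.2)
    (t : ℝ≥0) : Measurable (corr P c t) :=
  (measurable_corr hc).comp measurable_prodMk_left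

/-- The points `(0, 0)` and `(u, x)` are at distance at least `u` for every `x`, so the mixing bound
is uniform in space. -/
theorem abs_corr_le (hc : Measurable fun p : (ℝ≥0 × ℝ) × S => c p.1.1 p.1.2 p.2)
    (hK : ∀ t x s, |c t x s| ≤ K) (h0 : ∀ t x, ∫ s, c t x s ∂P = 0) {u : ℝ} (hu : 0 ≤ u)
    (x : ℝ) : |corr P c u.toNNReal x| ≤ 2 * K * K * alphaUm P c u := by
  have hK0 : 0 ≤ K := by
    obtain ⟨s⟩ := nonempty_of_isProbabilityMeasure P
    exact (abs_nonneg _).trans (hK 0 0 s)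
  have hfar : FarApart {(u.toNNReal, x)} {((0 : ℝ≥0), (0 : ℝ))} u := by
    rintro _ rfl _ rfl
    apply Real.le_sqrt_of_sq_le
    simp only [Real.coe_toNNReal u hu, NNReal.coe_zero]
    nlinarith [sq_nonneg x]
  have hi : Integrable (c 0 0) P := Integrable.of_bound
    (measurable_field_apply hc 0 0).aestronglyMeasurable K (Eventually.of_forall (hK 0 0))
  have h1 := abs_integral_mul_sub_le_alphaUm (P := P) hc hfar
    (measurable_sigmaField (mem_singleton _)).stronglyMeasurable.aestronglyMeasurable hi
    (measurable_sigmaField (mem_singleton _)) (hK u.toNNReal x)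
  rw [h0, zero_mul, sub_zero] at h1
  have h2 : ∫ s, |c 0 0 s| ∂P ≤ K :=
    (le_abs_self _).trans (abs_integral_le_of_abs_le_const fun s => by
      rw [abs_abs]; exact hK 0 0 s)
  have h3 := alphaUm_nonneg (P := P) (c := c) u
  calc _ ≤ 2 * K * alphaUm P c u * ∫ s, |c 0 0 s| ∂P := h1
    _ ≤ 2 * K * alphaUm P c u * K := by gcongr
    _ = _ := by ring

/-- The field need not be continuous in space. By stationarity the spatial base point `z` is
arbitrary, and averaging over `z ∈ [0, 1]` reduces the claim to the continuity of translations in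
mean, applied to each realisation. -/
theorem tendsto_corr_zero (hc : Measurable fun p : (ℝ≥0 × ℝ) × S => c p.1.1 p.1.2 p.2)
    (hK : ∀ t x s, |c t x s| ≤ K) (hstat : Stationary P c) (t : ℝ≥0) :
    Tendsto (corr P c t) (𝓝 0) (𝓝 (corr P c t 0)) := by
  have hK0 : 0 ≤ K := by
    obtain ⟨s⟩ := nonempty_of_isProbabilityMeasure P
    exact (abs_nonneg _).trans (hK 0 0 s)
  have hdm : ∀ y, Measurable (Function.uncurry fun (z : ℝ) (s : S) =>
      |c t (z + y) s - c t z s|) := by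
    intro y
    have h1 : Measurable fun p : ℝ × S => c t (p.1 + y) p.2 :=
      hc.comp (f := fun p : ℝ × S => ((t, p.1 + y), p.2)) (by fun_prop)
    have h2 : Measurable fun p : ℝ × S => c t p.1 p.2 :=
      hc.comp (f := fun p : ℝ × S => ((t, p.1), p.2)) (by fun_prop)
    exact (h1.sub h2).abs
  have hdb : ∀ y z s, |(|c t (z + y) s - c t z s|)| ≤ 2 * K := by
    intro y z s
    rw [abs_abs]
    refine (abs_sub _ _).trans ?_
    linarith [hK t (z + y) s, hK t z s]
  have hbound : ∀ y, |corr P c t y - corr P c t 0| ≤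
      K * ∫ s, (∫ z in (0 : ℝ)..1, |c t (z + y) s - c t z s|) ∂P := by
    intro y
    have h1 : ∀ z, |corr P c t y - corr P c t 0| ≤ K * ∫ s, |c t (z + y) s - c t z s| ∂P := by
      intro z
      have h2 := integral_mul_shift_eq_corr hc hstat 0 t z y
      have h3 := integral_mul_shift_eq_corr hc hstat 0 t z 0
      simp only [add_zero, zero_add] at h2 h3
      have hi : ∀ x, Integrable (fun s => c 0 z s * c t x s) P := fun x =>
        Integrable.of_bound (((measurable_field_apply hc 0 z).mul
          (measurable_field_apply hc t x)).aestronglyMeasurable) (K * K)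
          (Eventually.of_forall fun s => by
            rw [norm_mul]
            exact mul_le_mul (hK _ _ s) (hK _ _ s) (norm_nonneg _) hK0)
      have hi' : Integrable (fun s => |c t (z + y) s - c t z s|) P :=
        Integrable.of_bound ((hdm y).comp measurable_prodMk_left).aestronglyMeasurable (2 * K)
          (Eventually.of_forall fun s => hdb y z s)
      rw [← h2, ← h3, ← integral_sub (hi _) (hi _), ← integral_const_mul, add_comm y z]
      refine abs_integral_le_of_abs_le (hi'.const_mul K) (Eventually.of_forall fun s => ?_)
      rw [← mul_sub, abs_mul]
      exact mul_le_mul_of_nonneg_right (hK 0 z s) (abs_nonneg _)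
    rw [integral_intervalIntegral_swap (hdm y) zero_le_one (fun z _ s => hdb y z s),
      ← intervalIntegral.integral_const_mul]
    have h4 : IntervalIntegrable (fun z => K * ∫ s, |c t (z + y) s - c t z s| ∂P) volume 0 1 := by
      rw [intervalIntegrable_iff]
      refine Measure.integrableOn_of_bounded (M := K * (2 * K)) (by simp)
        (((hdm y).stronglyMeasurable.integral_prod_right (ν := P)).const_mul
          K).aestronglyMeasurable (Eventually.of_forall fun z => ?_)
      rw [Real.norm_eq_abs, abs_mul, abs_of_nonneg hK0]
      gcongr
      exact abs_integral_le_of_abs_le_const (hdb y z)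
    have h5 := intervalIntegral.integral_mono_on zero_le_one
      (intervalIntegrable_const (c := |corr P c t y - corr P c t 0|)) h4 (fun z _ => h1 z)
    simpa using h5
  have hlim : Tendsto (fun y => ∫ s, (∫ z in (0 : ℝ)..1, |c t (z + y) s - c t z s|) ∂P) (𝓝 0)
      (𝓝 (∫ _, (0 : ℝ) ∂P)) := by
    refine tendsto_integral_filter_of_dominated_convergence (fun _ => 2 * K)
      (Eventually.of_forall fun y => ?_) (Eventually.of_forall fun y =>
        Eventually.of_forall fun s => ?_) (integrable_const _) (Eventually.of_forall fun s => ?_)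
    · simp only [intervalIntegral.integral_of_le zero_le_one]
      exact (((hdm y).comp measurable_swap).stronglyMeasurable.integral_prod_right'
        (ν := volume.restrict (Ioc 0 1))).aestronglyMeasurable
    · have := intervalIntegral.norm_integral_le_of_norm_le_const (a := 0) (b := 1) (C := 2 * K)
        (f := fun z => |c t (z + y) s - c t z s|) (fun z _ => hdb y z s)
      simpa using this
    · exact tendsto_intervalIntegral_abs_translate_sub (g := fun z => c t z s)
        (hc.comp (f := fun z : ℝ => ((t, z), s)) (by fun_prop)) (fun z => hK t z s)
  rw [integral_zero] at hlim
  rw [tendsto_iff_norm_sub_tendsto_zero]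
  refine squeeze_zero (fun y => norm_nonneg _) hbound ?_
  simpa using hlim.const_mul K

theorem antitone_alphaUm : Antitone (alphaUm P c) := by
  intro a b hab
  refine csSup_le_csSup (bddAbove_mixingDefects P c a) ⟨0, zero_mem_mixingDefects P c b⟩ ?_
  rintro x ⟨A₁, A₂, hA, h⟩
  exact ⟨A₁, A₂, fun p hp q hq => hab.trans (hA p hp q hq), h⟩

theorem integrableOn_alphaUm (h : HUm P c) : IntegrableOn (alphaUm P c) (Ioi 0) := by
  obtain ⟨C, δ, hC, hδ, h⟩ := h
  have h1 : IntegrableOn (fun u : ℝ => C * (u + 1) ^ (-(2 + δ))) (Ioi 0) :=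
    (integrableOn_add_rpow_Ioi_of_lt (by linarith) (by norm_num)).const_mul C
  refine Integrable.mono' h1 antitone_alphaUm.measurable.aestronglyMeasurable ?_
  filter_upwards [ae_restrict_mem measurableSet_Ioi] with u hu
  rw [Real.norm_eq_abs, abs_of_nonneg (alphaUm_nonneg u), add_comm u 1]
  exact h u (le_of_lt hu)

theorem tendsto_alphaUm (h : HUm P c) : Tendsto (alphaUm P c) atTop (𝓝 0) := by
  obtain ⟨C, δ, hC, hδ, h⟩ := h
  have h1 : Tendsto (fun u : ℝ => C * (1 + u) ^ (-(2 + δ))) atTop (𝓝 (C * 0)) :=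
    ((tendsto_rpow_neg_atTop (by linarith)).comp
      (tendsto_atTop_add_const_left _ 1 tendsto_id)).const_mul C
  rw [mul_zero] at h1
  refine squeeze_zero' (Eventually.of_forall alphaUm_nonneg) ?_ h1
  filter_upwards [eventually_ge_atTop 0] with u hu using h u hu

end Correlation

/-! ### Time averages of processes with short-range correlations -/

section Averaging

variable {Ω : Type*} [MeasurableSpace Ω] {Q : Measure Ω} [IsProbabilityMeasure Q]

theorem measurable_intervalIntegral {Y : ℝ → Ω → ℝ} (hY : Measurable (Function.uncurry Y))
    (a b : ℝ) : Measurable fun ω => ∫ r in a..b, Y r ω := by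
  have hs : StronglyMeasurable (Function.uncurry fun (ω : Ω) (r : ℝ) => Y r ω) :=
    (hY.comp measurable_swap).stronglyMeasurable
  simp only [intervalIntegral]
  exact hs.integral_prod_right.measurable.sub hs.integral_prod_right.measurable

theorem abs_intervalIntegral_le_const {f : ℝ → ℝ} {t D : ℝ} (ht : 0 ≤ t)
    (h : ∀ r ∈ Ioc 0 t, |f r| ≤ D) : |∫ r in (0 : ℝ)..t, f r| ≤ D * t := by
  have := abs_intervalIntegral_le_of_abs_le ht h intervalIntegrable_const
  simpa [mul_comm] using this

/-- The average of a process whose covariances vanish at distance `ℓ` is small. -/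
theorem sq_integral_abs_average_le {Y : ℝ → Ω → ℝ} (hY : Measurable (Function.uncurry Y))
    {t D ℓ : ℝ} (ht : 0 ≤ t) (hℓ : 0 ≤ ℓ) (hD : ∀ r ∈ Icc 0 t, ∀ ω, |Y r ω| ≤ D)
    (h0 : ∀ r r', 0 ≤ r → r + ℓ ≤ r' → ∫ ω, Y r ω * Y r' ω ∂Q = 0) :
    (∫ ω, |∫ r in (0 : ℝ)..t, Y r ω| ∂Q) ^ 2 ≤ D ^ 2 * (2 * ℓ) * t := by
  obtain ⟨ω₀⟩ := nonempty_of_isProbabilityMeasure Q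
  have hD0 : 0 ≤ D := (abs_nonneg _).trans (hD 0 ⟨le_rfl, ht⟩ ω₀)
  have hYm : ∀ r, Measurable (Y r) := fun r => hY.comp measurable_prodMk_left
  set I : Ω → ℝ := fun ω => ∫ r in (0 : ℝ)..t, Y r ω with hI
  have hIm : Measurable I := measurable_intervalIntegral hY 0 t
  have hIb : ∀ ω, |I ω| ≤ D * t := fun ω =>
    abs_intervalIntegral_le_const ht fun r hr => hD r (Ioc_subset_Icc_self hr) ω
  have hmem : MemLp (fun ω => |I ω|) 2 Q :=
    MemLp.of_bound hIm.abs.aestronglyMeasurable (D * t)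
      (Eventually.of_forall fun ω => by rw [Real.norm_eq_abs, abs_abs]; exact hIb ω)
  -- Nonnegativity of the variance of `|I|` gives `(E|I|)² ≤ E I²`. The second moment is a double
  -- time integral of covariances.
  have hvar := variance_nonneg (fun ω => |I ω|) Q
  rw [variance_eq_sub hmem] at hvar
  refine (sub_nonneg.1 hvar).trans ?_
  have h1 : ∫ ω, ((fun ω => |I ω|) ^ 2) ω ∂Q = ∫ ω, (∫ r in (0 : ℝ)..t, Y r ω * I ω) ∂Q := by
    refine integral_congr_ae (Eventually.of_forall fun ω => ?_)
    simp only [Pi.pow_apply, sq_abs, intervalIntegral.integral_mul_const]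
    rw [pow_two]
  have hm1 : Measurable (Function.uncurry fun (r : ℝ) (ω : Ω) => Y r ω * I ω) :=
    hY.mul (hIm.comp measurable_snd)
  rw [h1, integral_intervalIntegral_swap hm1 ht (C := D * (D * t)) fun r hr ω => by
    rw [abs_mul]
    exact mul_le_mul (hD r (Ioc_subset_Icc_self hr) ω) (hIb ω) (abs_nonneg _) hD0]
  refine (le_abs_self _).trans (abs_intervalIntegral_le_const ht fun r hr => ?_)
  have h2 : ∫ ω, Y r ω * I ω ∂Q = ∫ r' in (0 : ℝ)..t, (∫ ω, Y r ω * Y r' ω ∂Q) := by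
    have hm2 : Measurable (Function.uncurry fun (r' : ℝ) (ω : Ω) => Y r ω * Y r' ω) :=
      ((hYm r).comp measurable_snd).mul hY
    rw [← integral_intervalIntegral_swap hm2 ht (C := D * D) fun r' hr' ω => by
      rw [abs_mul]
      exact mul_le_mul (hD r (Ioc_subset_Icc_self hr) ω) (hD r' (Ioc_subset_Icc_self hr') ω)
        (abs_nonneg _) hD0]
    simp only [intervalIntegral.integral_const_mul, hI]
  -- For fixed `r`, only the times `r'` within distance `ℓ` of `r` contribute, each at most `D ^ 2`.
  have hind : Integrable ((Ioo (r - ℓ) (r + ℓ)).indicator fun _ : ℝ => D ^ 2) :=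
    (integrable_indicator_iff measurableSet_Ioo).2 (integrableOn_const (by simp))
  rw [h2]
  refine (abs_intervalIntegral_le_of_abs_le ht
    (g := (Ioo (r - ℓ) (r + ℓ)).indicator fun _ : ℝ => D ^ 2) (fun r' hr' => ?_)
    hind.intervalIntegrable).trans ?_
  · by_cases hmem' : r' ∈ Ioo (r - ℓ) (r + ℓ)
    · rw [indicator_of_mem hmem', pow_two]
      refine abs_integral_le_of_abs_le_const fun ω => ?_
      rw [abs_mul]
      exact mul_le_mul (hD r (Ioc_subset_Icc_self hr) ω) (hD r' (Ioc_subset_Icc_self hr') ω)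
        (abs_nonneg _) hD0
    · rw [indicator_of_notMem hmem']
      have h3 : ∫ ω, Y r ω * Y r' ω ∂Q = 0 := by
        rcases le_or_gt r' (r - ℓ) with h4 | h4
        · simp only [mul_comm (Y r _)]
          exact h0 r' r hr'.1.le (by linarith)
        · exact h0 r r' hr.1.le (not_lt.1 fun h5 => hmem' ⟨h4, h5⟩)
      rw [h3, abs_zero]
  · rw [intervalIntegral.integral_of_le ht]
    refine (setIntegral_le_integral hind (Eventually.of_forall fun x =>
      indicator_nonneg (fun _ _ => sq_nonneg D) x)).trans (le_of_eq ?_)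
    rw [integral_indicator measurableSet_Ioo, setIntegral_const, smul_eq_mul,
      Real.volume_real_Ioo_of_le (by linarith)]
    ring

end Averaging

/-! ### Scaled increments of Brownian motion -/

section Brownian

variable {Ω : Type*} [MeasurableSpace Ω] {Q : Measure Ω} {B : ℝ≥0 → Ω → ℝ}

/-- The increment of `B` between the times `r` and `r + ε u`, in the scale `ε ^ β`. -/
noncomputable def scaledIncrement (B : ℝ≥0 → Ω → ℝ) (β ε r u : ℝ) (ω : Ω) : ℝ :=
  (B (r + ε * u).toNNReal ω - B r.toNNReal ω) / ε ^ β

theorem measurable_scaledIncrement (hBm : Measurable (Function.uncurry B)) (β ε : ℝ) :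
    Measurable fun p : (ℝ × ℝ) × Ω => scaledIncrement B β ε p.1.1 p.1.2 p.2 := by
  have h1 : Measurable fun p : (ℝ × ℝ) × Ω => B (p.1.1 + ε * p.1.2).toNNReal p.2 :=
    hBm.comp (f := fun p : (ℝ × ℝ) × Ω => ((p.1.1 + ε * p.1.2).toNNReal, p.2)) (by fun_prop)
  have h2 : Measurable fun p : (ℝ × ℝ) × Ω => B p.1.1.toNNReal p.2 :=
    hBm.comp (f := fun p : (ℝ × ℝ) × Ω => (p.1.1.toNNReal, p.2)) (by fun_prop)
  exact (h1.sub h2).div_const _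

/-- By stationarity of increments and Brownian scaling, the increment over a time `ε u` has the law
of `√ε B_u`. Division by `ε ^ β` leaves the power `1/2 - β`. -/
theorem integral_comp_scaledIncrement (hB : IsPreBrownianReal B Q) {β ε r u : ℝ} (hε : 0 < ε)
    (hr : 0 ≤ r) (hu : 0 ≤ u) {f : ℝ → ℝ} (hf : Measurable f) :
    ∫ ω, f (scaledIncrement B β ε r u ω) ∂Q = ∫ ω, f (ε ^ (1 / 2 - β) * B u.toNNReal ω) ∂Q := by
  have hε' : ε.toNNReal ≠ 0 := by simpa using hε
  have h1 := ((hB.shift r.toNNReal).smul hε').hasLaw_eval u.toNNReal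
  have h2 := hB.hasLaw_eval u.toNNReal
  have hg : Measurable fun y : ℝ => f (ε ^ (1 / 2 - β) * y) := hf.comp (measurable_const_mul _)
  have h3 := h1.integral_comp hg.aestronglyMeasurable
  have h4 := h2.integral_comp hg.aestronglyMeasurable
  refine Eq.trans (integral_congr_ae (Eventually.of_forall fun ω => ?_)) (h3.trans h4.symm)
  simp only [Function.comp_apply, scaledIncrement]
  congr 1
  rw [Real.toNNReal_add hr (mul_nonneg hε.le hu), Real.toNNReal_mul hε.le, Real.coe_toNNReal ε hε.le,
    Real.rpow_sub hε, ← Real.sqrt_eq_rpow]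
  have : √ε ≠ 0 := (Real.sqrt_pos.2 hε).ne'
  field_simp

/-- The first increment is a function of the path up to `r'`, the second a function of the path
after `r'` relative to its value there. -/
theorem indepFun_scaledIncrement (hB : IsPreBrownianReal B Q) {β ε r r' u : ℝ} (hε : 0 < ε)
    (hr : 0 ≤ r) (hu : 0 ≤ u) (hr' : r + ε * u ≤ r') :
    IndepFun (scaledIncrement B β ε r u) (scaledIncrement B β ε r' u) Q := by
  have hεu : 0 ≤ ε * u := mul_nonneg hε.le hu
  have h1 := (hB.indepFun_shift r'.toNNReal).symm
  have ha : r.toNNReal ≤ r'.toNNReal := Real.toNNReal_le_toNNReal (by linarith)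
  have hb : (r + ε * u).toNNReal ≤ r'.toNNReal := Real.toNNReal_le_toNNReal hr'
  have h2 := h1.comp (φ := fun g : Iic r'.toNNReal → ℝ =>
      (g ⟨(r + ε * u).toNNReal, hb⟩ - g ⟨r.toNNReal, ha⟩) / ε ^ β)
    (ψ := fun g : ℝ≥0 → ℝ => g (ε * u).toNNReal / ε ^ β) (by fun_prop) (by fun_prop)
  have h3 : scaledIncrement B β ε r' u = (fun g : ℝ≥0 → ℝ => g (ε * u).toNNReal / ε ^ β) ∘
      fun ω t => B (r'.toNNReal + t) ω - B r'.toNNReal ω := by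
    funext ω
    simp only [Function.comp_apply, scaledIncrement]
    rw [Real.toNNReal_add (by linarith : 0 ≤ r') hεu]
  rw [h3]
  exact h2

variable [IsProbabilityMeasure Q] {Φ : ℝ≥0 → ℝ → ℝ} {θ : ℝ → ℝ}

/-- Below the critical exponent the increments tend to `0` in law at each fixed `r`, so averaging in
`r` is not what produces the limit: the absolute value is taken inside the time integral. -/
theorem tendsto_integral_abs_average_of_lt (hB : IsPreBrownianReal B Q)
    (hBm : Measurable (Function.uncurry B)) {β : ℝ} (hβ : β < 1 / 2) {t u : ℝ} (ht : 0 ≤ t)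
    (hu : 0 ≤ u) {f : ℝ → ℝ} (hf : Measurable f) {D : ℝ} (hD : ∀ x, |f x| ≤ D)
    (hf0 : Tendsto f (𝓝 0) (𝓝 (f 0))) :
    Tendsto (fun ε => ∫ ω, |∫ r in (0 : ℝ)..t, (f (scaledIncrement B β ε r u ω) - f 0)| ∂Q)
      (𝓝[>] 0) (𝓝 0) := by
  have hd : ∀ x, |f x - f 0| ≤ 2 * D := fun x => (abs_sub _ _).trans (by linarith [hD x, hD 0])
  have hBum : Measurable (B u.toNNReal) := hBm.comp measurable_prodMk_left
  have hlim : Tendsto (fun ε : ℝ => ∫ ω, |f (ε ^ (1 / 2 - β) * B u.toNNReal ω) - f 0| ∂Q)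
      (𝓝[>] 0) (𝓝 (∫ _, (0 : ℝ) ∂Q)) := by
    refine tendsto_integral_filter_of_dominated_convergence (fun _ => 2 * D)
      (Eventually.of_forall fun ε => ?_) (Eventually.of_forall fun ε =>
        Eventually.of_forall fun ω => ?_) (integrable_const _) (Eventually.of_forall fun ω => ?_)
    · exact ((hf.comp (hBum.const_mul _)).sub_const _).abs.aestronglyMeasurable
    · rw [Real.norm_eq_abs, abs_abs]; exact hd _
    · have h1 : Tendsto (fun ε : ℝ => ε ^ (1 / 2 - β) * B u.toNNReal ω) (𝓝[>] 0) (𝓝 0) := by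
        have h2 : ContinuousAt (fun ε : ℝ => ε ^ (1 / 2 - β)) 0 :=
          Real.continuousAt_rpow_const _ _ (Or.inr (by linarith))
        have h3 := (h2.tendsto.mono_left (nhdsWithin_le_nhds (s := Ioi 0))).mul_const
          (B u.toNNReal ω)
        rwa [Real.zero_rpow (by linarith), zero_mul] at h3
      have h4 := ((hf0.comp h1).sub_const (f 0)).abs
      simpa using h4
  rw [integral_zero] at hlim
  have hlim' := hlim.mul_const t
  rw [zero_mul] at hlim'
  refine squeeze_zero' (Eventually.of_forall fun ε => integral_nonneg fun ω => abs_nonneg _) ?_ hlim'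
  filter_upwards [self_mem_nhdsWithin] with ε hε
  have hm : Measurable (Function.uncurry fun (r : ℝ) (ω : Ω) =>
      |f (scaledIncrement B β ε r u ω) - f 0|) := by
    have := (measurable_scaledIncrement hBm β ε).comp
      (f := fun p : ℝ × Ω => ((p.1, u), p.2)) (by fun_prop)
    exact ((hf.comp this).sub_const _).abs
  have h1 : ∫ ω, |∫ r in (0 : ℝ)..t, (f (scaledIncrement B β ε r u ω) - f 0)| ∂Q ≤
      ∫ ω, (∫ r in (0 : ℝ)..t, |f (scaledIncrement B β ε r u ω) - f 0|) ∂Q := by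
    refine integral_mono_of_nonneg (Eventually.of_forall fun ω => abs_nonneg _) ?_
      (Eventually.of_forall fun ω => intervalIntegral.abs_integral_le_integral_abs ht)
    refine Integrable.of_bound (measurable_intervalIntegral hm 0 t).aestronglyMeasurable
      (2 * D * t) (Eventually.of_forall fun ω => abs_intervalIntegral_le_const ht fun r _ => ?_)
    rw [abs_abs]; exact hd _
  refine h1.trans (le_of_eq ?_)
  rw [integral_intervalIntegral_swap hm ht (C := 2 * D) fun r _ ω => by rw [abs_abs]; exact hd _]
  rw [intervalIntegral.integral_congr
    (g := fun _ => ∫ ω, |f (ε ^ (1 / 2 - β) * B u.toNNReal ω) - f 0| ∂Q)]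
  · simp [mul_comm]
  · intro r hr
    rw [uIcc_of_le ht] at hr
    exact integral_comp_scaledIncrement hB hε hr.1 hu (f := fun x => |f x - f 0|)
      ((hf.sub_const _).abs)

/-- At `β = 1/2` the law of the increments does not depend on `ε`, and the limit comes from
averaging in `r`. Independence beyond the time distance `ε u` makes the second moment of the centred
average `O(ε)`. -/
theorem tendsto_integral_abs_average_half (hB : IsPreBrownianReal B Q)
    (hBm : Measurable (Function.uncurry B)) {t u : ℝ} (ht : 0 ≤ t)
    (hu : 0 ≤ u) {f : ℝ → ℝ} (hf : Measurable f) {D : ℝ} (hD : ∀ x, |f x| ≤ D) :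
    Tendsto (fun ε => ∫ ω, |∫ r in (0 : ℝ)..t, (f (scaledIncrement B (1 / 2) ε r u ω) -
      ∫ ω', f (B u.toNNReal ω') ∂Q)| ∂Q) (𝓝[>] 0) (𝓝 0) := by
  set m := ∫ ω', f (B u.toNNReal ω') ∂Q with hm
  have hmD : |m| ≤ D := abs_integral_le_of_abs_le_const fun ω => hD _
  have hd : ∀ x, |f x - m| ≤ 2 * D := fun x => (abs_sub _ _).trans (by linarith [hD x])
  have hbound : ∀ ε : ℝ, 0 < ε → ∫ ω, |∫ r in (0 : ℝ)..t,
      (f (scaledIncrement B (1 / 2) ε r u ω) - m)| ∂Q ≤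
      √((2 * D) ^ 2 * (2 * (ε * u)) * t) := by
    intro ε hε
    have hYm : Measurable (Function.uncurry fun (r : ℝ) (ω : Ω) =>
        f (scaledIncrement B (1 / 2) ε r u ω) - m) := by
      have := (measurable_scaledIncrement hBm (1 / 2) ε).comp
        (f := fun p : ℝ × Ω => ((p.1, u), p.2)) (by fun_prop)
      exact (hf.comp this).sub_const _
    apply Real.le_sqrt_of_sq_le
    refine sq_integral_abs_average_le hYm ht (mul_nonneg hε.le hu) (fun r _ ω => hd _) ?_
    intro r r' hr hrr'
    have hind := (indepFun_scaledIncrement hB (β := 1 / 2) hε hr hu hrr').comp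
      (φ := fun x => f x - m) (ψ := fun x => f x - m) (hf.sub_const m) (hf.sub_const m)
    have h1 := hind.integral_mul_eq_mul_integral
      (hYm.comp measurable_prodMk_left).aestronglyMeasurable
      (hYm.comp measurable_prodMk_left).aestronglyMeasurable
    refine h1.trans ?_
    have h2 : ∫ ω, (f (scaledIncrement B (1 / 2) ε r u ω) - m) ∂Q = 0 := by
      rw [integral_comp_scaledIncrement hB hε hr hu (hf.sub_const m)]
      have hi : Integrable (fun ω => f (B u.toNNReal ω)) Q :=
        Integrable.of_bound (hf.comp (hBm.comp measurable_prodMk_left)).aestronglyMeasurable D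
          (Eventually.of_forall fun ω => hD _)
      simp only [sub_self, Real.rpow_zero, one_mul]
      rw [integral_sub hi (integrable_const _)]
      simp [hm]
    exact mul_eq_zero_of_left h2 _
  have hlim : Tendsto (fun ε : ℝ => √((2 * D) ^ 2 * (2 * (ε * u)) * t)) (𝓝[>] 0) (𝓝 0) := by
    have : Continuous fun ε : ℝ => √((2 * D) ^ 2 * (2 * (ε * u)) * t) := by fun_prop
    have h1 := (this.tendsto 0).mono_left (nhdsWithin_le_nhds (s := Ioi 0))
    simpa using h1
  refine squeeze_zero' (Eventually.of_forall fun ε => integral_nonneg fun ω => abs_nonneg _) ?_ hlim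
  filter_upwards [self_mem_nhdsWithin] with ε hε using hbound ε hε

/-- The time averages of a function of the scaled increments of Brownian motion converge
in mean. -/
theorem tendsto_integral_abs_average (hB : IsPreBrownianReal B Q)
    (hBm : Measurable (Function.uncurry B)) {β : ℝ} (hβ : β ≤ 1 / 2) {t u : ℝ} (ht : 0 ≤ t)
    (hu : 0 ≤ u) {f : ℝ → ℝ} (hf : Measurable f) {D : ℝ} (hD : ∀ x, |f x| ≤ D)
    (hf0 : Tendsto f (𝓝 0) (𝓝 (f 0))) :
    Tendsto (fun ε => ∫ ω, |∫ r in (0 : ℝ)..t, (f (scaledIncrement B β ε r u ω) -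
      if β < 1 / 2 then f 0 else ∫ ω', f (B u.toNNReal ω') ∂Q)| ∂Q) (𝓝[>] 0) (𝓝 0) := by
  rcases hβ.lt_or_eq with h | rfl
  · simpa only [if_pos h] using tendsto_integral_abs_average_of_lt hB hBm h ht hu hf hD hf0
  · simpa only [lt_irrefl, if_false] using tendsto_integral_abs_average_half hB hBm ht hu hf hD

end Brownian

/-! ### Vanishing of the comparison error -/

theorem tendsto_comparisonError {θ : ℝ → ℝ} (hθ0 : ∀ u, 0 ≤ u → 0 ≤ θ u)
    (hθ : IntegrableOn θ (Ioi 0)) (hθlim : Tendsto θ atTop (𝓝 0)) {K : ℝ} (hK : 0 ≤ K) {t : ℝ}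
    (ht : 0 ≤ t) :
    Tendsto (fun ε : ℝ => WeaklyDependent.comparisonError ε K (ε ^ (-(1 / 4) : ℝ)) t θ) (𝓝[>] 0)
      (𝓝 0) := by
  -- The gap `L = ε^{-1/4}` tends to infinity, so `θ L → 0`, while `ε^{-1/2} · ε L = ε^{1/4}` still
  -- tends to `0`.
  have hgap : Tendsto (fun ε : ℝ => WeaklyDependent.gapError ε K (ε ^ (-(1 / 4) : ℝ)) θ) (𝓝[>] 0)
      (𝓝 0) := by
    have h1 : Tendsto (fun ε : ℝ => θ (ε ^ (-(1 / 4) : ℝ))) (𝓝[>] 0) (𝓝 0) :=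
      hθlim.comp (tendsto_rpow_neg_nhdsGT_zero (by norm_num))
    have h2 : Tendsto (fun ε : ℝ => 2 * (K * K * (Real.exp (K * ε ^ (1 / 4 : ℝ)) - 1))) (𝓝[>] 0)
        (𝓝 0) := by
      have h3 : ContinuousAt (fun ε : ℝ => ε ^ (1 / 4 : ℝ)) 0 :=
        Real.continuousAt_rpow_const _ _ (Or.inr (by norm_num))
      have h4 := (((h3.tendsto.mono_left (nhdsWithin_le_nhds (s := Ioi 0))).const_mul
        K).rexp.sub_const 1).const_mul (K * K) |>.const_mul 2
      rw [Real.zero_rpow (by norm_num), mul_zero, Real.exp_zero, sub_self, mul_zero, mul_zero] at h4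
      exact h4
    have h5 := h2.add h1
    rw [add_zero] at h5
    refine h5.congr' ?_
    filter_upwards [self_mem_nhdsWithin] with ε (hε : 0 < ε)
    have h6 : (√ε)⁻¹ * (K * (ε * ε ^ (-(1 / 4) : ℝ))) = K * ε ^ (1 / 4 : ℝ) := by
      have h7 : (√ε)⁻¹ * (ε * ε ^ (-(1 / 4) : ℝ)) = ε ^ (1 / 4 : ℝ) := by
        rw [Real.sqrt_eq_rpow, ← Real.rpow_neg hε.le]
        nth_rewrite 2 [← Real.rpow_one ε]
        rw [← Real.rpow_add hε, ← Real.rpow_add hε]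
        norm_num
      rw [← h7]; ring
    rw [WeaklyDependent.gapError, h6]
  have hgap0 : ∀ᶠ ε : ℝ in 𝓝[>] 0, 0 ≤ WeaklyDependent.gapError ε K (ε ^ (-(1 / 4) : ℝ)) θ := by
    filter_upwards [self_mem_nhdsWithin] with ε (hε : 0 < ε)
    have h1 : 0 ≤ (√ε)⁻¹ * (K * (ε * ε ^ (-(1 / 4) : ℝ))) := by positivity
    have h2 := Real.one_le_exp h1
    have h3 := hθ0 (ε ^ (-(1 / 4) : ℝ)) (by positivity)
    have h4 := mul_nonneg (mul_nonneg hK hK) (sub_nonneg.2 h2)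
    unfold WeaklyDependent.gapError
    linarith
  have hmin : Tendsto (fun ε : ℝ => ∫ u in Ioi (0 : ℝ),
      min (2 * θ u) (WeaklyDependent.gapError ε K (ε ^ (-(1 / 4) : ℝ)) θ)) (𝓝[>] 0)
      (𝓝 (∫ _ in Ioi (0 : ℝ), (0 : ℝ))) := by
    refine tendsto_integral_filter_of_dominated_convergence (fun u => 2 * θ u)
      (Eventually.of_forall fun ε =>
        (hθ.const_mul 2).aestronglyMeasurable.inf aestronglyMeasurable_const) ?_
      (hθ.const_mul 2) ?_
    · filter_upwards [hgap0] with ε hε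
      filter_upwards [ae_restrict_mem measurableSet_Ioi] with u hu
      have := hθ0 u (le_of_lt hu)
      rw [Real.norm_eq_abs, abs_of_nonneg (le_min (by positivity) hε)]
      exact min_le_left _ _
    · filter_upwards [ae_restrict_mem measurableSet_Ioi] with u hu
      have h1 := (tendsto_const_nhds (x := 2 * θ u)).min hgap
      rwa [min_eq_right (mul_nonneg zero_le_two (hθ0 u (le_of_lt hu)))] at h1
  -- For fixed `r > 0` the lower limit `r / ε` tends to infinity, and the full integral of `θ`
  -- dominates.
  have htail : Tendsto (fun ε : ℝ => ∫ r in (0 : ℝ)..t, ∫ u in Ioi (r / ε), θ u) (𝓝[>] 0)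
      (𝓝 (∫ _ in (0 : ℝ)..t, (0 : ℝ))) := by
    have htail0 : Tendsto (fun x => ∫ u in Ioi x, θ u) atTop (𝓝 0) := by
      have h1 := (intervalIntegral_tendsto_integral_Ioi 0 hθ tendsto_id).const_sub
        (∫ u in Ioi (0 : ℝ), θ u)
      rw [sub_self] at h1
      refine h1.congr' ?_
      filter_upwards [eventually_ge_atTop 0] with x hx
      rw [id, intervalIntegral.integral_of_le hx, sub_eq_iff_eq_add', ← Ioc_union_Ioi_eq_Ioi hx,
        setIntegral_union (t := Ioi x)
          (Set.disjoint_left.2 fun u hu hu' => (not_lt.2 hu.2) hu') measurableSet_Ioi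
          (hθ.mono_set Ioc_subset_Ioi_self) (hθ.mono_set (Ioi_subset_Ioi hx))]
    refine intervalIntegral.tendsto_integral_filter_of_dominated_convergence
      (fun _ => ∫ u in Ioi (0 : ℝ), θ u) ?_ ?_ intervalIntegrable_const ?_
    · filter_upwards [self_mem_nhdsWithin] with ε (hε : 0 < ε)
      rw [uIoc_of_le ht]
      exact (intervalIntegrable_tail hθ0 hε hθ ht).1.aestronglyMeasurable
    · filter_upwards [self_mem_nhdsWithin] with ε (hε : 0 < ε)
      refine Eventually.of_forall fun r hr => ?_
      rw [uIoc_of_le ht] at hr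
      have hr' : 0 ≤ r / ε := div_nonneg hr.1.le hε.le
      rw [Real.norm_eq_abs, abs_of_nonneg (setIntegral_nonneg measurableSet_Ioi fun u hu =>
        hθ0 u (hr'.trans (le_of_lt hu)))]
      refine setIntegral_mono_set hθ ?_ (Ioi_subset_Ioi hr').eventuallyLE
      filter_upwards [ae_restrict_mem measurableSet_Ioi] with u hu using hθ0 u (le_of_lt hu)
    · refine Eventually.of_forall fun r hr => ?_
      rw [uIoc_of_le ht] at hr
      have h1 : Tendsto (fun ε : ℝ => r / ε) (𝓝[>] 0) atTop :=
        tendsto_inv_nhdsGT_zero.const_mul_atTop hr.1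
      exact htail0.comp h1
  have h1 := (hmin.const_mul t).add htail
  simpa [WeaklyDependent.comparisonError] using h1

/-! ### Convergence of the conditional variance -/

section Brownian

variable {S Ω : Type*} [MeasurableSpace S] [MeasurableSpace Ω] {P : Measure S}
  [IsProbabilityMeasure P] {Q : Measure Ω} [IsProbabilityMeasure Q] {c : ℝ≥0 → ℝ → S → ℝ}
  {B : ℝ≥0 → Ω → ℝ} {K : ℝ}

theorem stronglyMeasurable_sigmaIntegrand
    (hc : Measurable fun p : (ℝ≥0 × ℝ) × S => c p.1.1 p.1.2 p.2)
    (hBm : Measurable (Function.uncurry B)) (β : ℝ) :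
    StronglyMeasurable (sigmaIntegrand P Q c B β) := by
  by_cases h : β < 1 / 2
  · have h1 : sigmaIntegrand P Q c B β = fun u => corr P c u.toNNReal 0 :=
      funext fun u => if_pos h
    rw [h1]
    exact ((measurable_corr hc).comp
      (f := fun u : ℝ => (u.toNNReal, (0 : ℝ))) (by fun_prop)).stronglyMeasurable
  · have h3 : sigmaIntegrand P Q c B β =
        fun u => ∫ ω, corr P c u.toNNReal (B u.toNNReal ω) ∂Q := funext fun u => if_neg h
    rw [h3]
    have h1 : Measurable fun p : ℝ × Ω => B p.1.toNNReal p.2 :=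
      hBm.comp (f := fun p : ℝ × Ω => (p.1.toNNReal, p.2)) (by fun_prop)
    have h2 : Measurable fun p : ℝ × Ω => corr P c p.1.toNNReal (B p.1.toNNReal p.2) :=
      (measurable_corr hc).comp (f := fun p : ℝ × Ω => (p.1.toNNReal, B p.1.toNNReal p.2))
        ((measurable_real_toNNReal.comp measurable_fst).prodMk h1)
    exact h2.stronglyMeasurable.integral_prod_right'

theorem abs_sigmaIntegrand_le (hc : Measurable fun p : (ℝ≥0 × ℝ) × S => c p.1.1 p.1.2 p.2)
    (hK : ∀ t x s, |c t x s| ≤ K) (h0 : ∀ t x, ∫ s, c t x s ∂P = 0) (β : ℝ) {u : ℝ} (hu : 0 ≤ u) :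
    |sigmaIntegrand P Q c B β u| ≤ 2 * K * K * alphaUm P c u := by
  unfold sigmaIntegrand
  split_ifs
  · exact abs_corr_le hc hK h0 hu _
  · exact abs_integral_le_of_abs_le_const fun ω => abs_corr_le hc hK h0 hu _

theorem integrableOn_sigmaIntegrand
    (hc : Measurable fun p : (ℝ≥0 × ℝ) × S => c p.1.1 p.1.2 p.2)
    (hK : ∀ t x s, |c t x s| ≤ K) (h0 : ∀ t x, ∫ s, c t x s ∂P = 0) (hmix : HUm P c)
    (hBm : Measurable (Function.uncurry B)) (β : ℝ) :
    IntegrableOn (sigmaIntegrand P Q c B β) (Ioi 0) := by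
  refine Integrable.mono' ((integrableOn_alphaUm hmix).const_mul (2 * K * K))
    (stronglyMeasurable_sigmaIntegrand hc hBm β).aestronglyMeasurable ?_
  filter_upwards [ae_restrict_mem measurableSet_Ioi] with u hu
  exact abs_sigmaIntegrand_le hc hK h0 β (le_of_lt hu)

/-- Half of the asymptotic variance of the exponent, given the Brownian path. -/
noncomputable def pathVariance (P : Measure S) (c : ℝ≥0 → ℝ → S → ℝ) (B : ℝ≥0 → Ω → ℝ)
    (β t ε : ℝ) (ω : Ω) : ℝ :=
  ∫ r in (0 : ℝ)..t, ∫ u in Ioi (0 : ℝ), corr P c u.toNNReal (scaledIncrement B β ε r u ω)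

theorem measurable_corr_scaledIncrement
    (hc : Measurable fun p : (ℝ≥0 × ℝ) × S => c p.1.1 p.1.2 p.2)
    (hBm : Measurable (Function.uncurry B)) (β ε : ℝ) :
    Measurable fun p : (ℝ × ℝ) × Ω =>
      corr P c p.1.2.toNNReal (scaledIncrement B β ε p.1.1 p.1.2 p.2) := by
  have h1 : Measurable fun p : (ℝ × ℝ) × Ω => p.1.2.toNNReal := by fun_prop
  exact (measurable_corr hc).comp (h1.prodMk (measurable_scaledIncrement hBm β ε))

theorem measurable_integral_corr_scaledIncrement
    (hc : Measurable fun p : (ℝ≥0 × ℝ) × S => c p.1.1 p.1.2 p.2)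
    (hBm : Measurable (Function.uncurry B)) (β ε : ℝ) :
    Measurable (Function.uncurry fun (r : ℝ) (ω : Ω) =>
      ∫ u in Ioi (0 : ℝ), corr P c u.toNNReal (scaledIncrement B β ε r u ω)) := by
  have h1 := (measurable_corr_scaledIncrement (P := P) hc hBm β ε).comp
    (f := fun p : (ℝ × Ω) × ℝ => ((p.1.1, p.2), p.1.2)) (by fun_prop)
  exact (h1.stronglyMeasurable.integral_prod_right' (ν := volume.restrict (Ioi 0))).measurable

theorem measurable_pathVariance
    (hc : Measurable fun p : (ℝ≥0 × ℝ) × S => c p.1.1 p.1.2 p.2)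
    (hBm : Measurable (Function.uncurry B)) (β t ε : ℝ) :
    Measurable (pathVariance P c B β t ε) :=
  measurable_intervalIntegral (measurable_integral_corr_scaledIncrement hc hBm β ε) 0 t

theorem abs_integral_corr_le (hc : Measurable fun p : (ℝ≥0 × ℝ) × S => c p.1.1 p.1.2 p.2)
    (hK : ∀ t x s, |c t x s| ≤ K) (h0 : ∀ t x, ∫ s, c t x s ∂P = 0) (hmix : HUm P c)
    (y : ℝ → ℝ) : |∫ u in Ioi (0 : ℝ), corr P c u.toNNReal (y u)| ≤
      ∫ u in Ioi (0 : ℝ), 2 * K * K * alphaUm P c u := by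
  refine abs_integral_le_of_abs_le ((integrableOn_alphaUm hmix).const_mul _) ?_
  filter_upwards [ae_restrict_mem measurableSet_Ioi] with u hu
  exact abs_corr_le hc hK h0 (le_of_lt hu) _

theorem abs_pathVariance_le {Ω : Type*} {B : ℝ≥0 → Ω → ℝ}
    (hc : Measurable fun p : (ℝ≥0 × ℝ) × S => c p.1.1 p.1.2 p.2)
    (hK : ∀ t x s, |c t x s| ≤ K) (h0 : ∀ t x, ∫ s, c t x s ∂P = 0) (hmix : HUm P c)
    {t : ℝ} (ht : 0 ≤ t) (β ε : ℝ) (ω : Ω) :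
    |pathVariance P c B β t ε ω| ≤ (∫ u in Ioi (0 : ℝ), 2 * K * K * alphaUm P c u) * t :=
  abs_intervalIntegral_le_const ht fun _ _ => abs_integral_corr_le hc hK h0 hmix _

/-- Fubini puts the lag `u` outermost, so that for each fixed lag the time averages in `r` can be
treated by `tendsto_integral_abs_average`. -/
theorem pathVariance_sub_eq (hc : Measurable fun p : (ℝ≥0 × ℝ) × S => c p.1.1 p.1.2 p.2)
    (hK : ∀ t x s, |c t x s| ≤ K) (h0 : ∀ t x, ∫ s, c t x s ∂P = 0) (hmix : HUm P c)
    (hBm : Measurable (Function.uncurry B)) {t : ℝ} (ht : 0 ≤ t) (β ε : ℝ) (ω : Ω) :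
    pathVariance P c B β t ε ω - t * sigmaConst P Q c B β =
      ∫ u in Ioi (0 : ℝ), ∫ r in (0 : ℝ)..t,
        (corr P c u.toNNReal (scaledIncrement B β ε r u ω) - sigmaIntegrand P Q c B β u) := by
  have hα := integrableOn_alphaUm hmix
  have hm := measurable_corr_scaledIncrement (P := P) hc hBm β ε
  have hG := integrableOn_sigmaIntegrand (Q := Q) hc hK h0 hmix hBm β
  have hcorr : ∀ r, IntegrableOn
      (fun u => corr P c u.toNNReal (scaledIncrement B β ε r u ω)) (Ioi 0) := by
    intro r
    refine Integrable.mono' (hα.const_mul (2 * K * K))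
      (hm.comp (f := fun u : ℝ => ((r, u), ω)) (by fun_prop)).aestronglyMeasurable ?_
    filter_upwards [ae_restrict_mem measurableSet_Ioi] with u hu
    exact abs_corr_le hc hK h0 (le_of_lt hu) _
  have hrate : IntervalIntegrable (fun r => ∫ u in Ioi (0 : ℝ),
      corr P c u.toNNReal (scaledIncrement B β ε r u ω)) volume 0 t := by
    rw [intervalIntegrable_iff]
    exact Measure.integrableOn_of_bounded
      (M := ∫ u in Ioi (0 : ℝ), 2 * K * K * alphaUm P c u) (by simp)
      ((measurable_integral_corr_scaledIncrement hc hBm β ε).comp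
        (f := fun r : ℝ => (r, ω)) (by fun_prop)).aestronglyMeasurable
      (Eventually.of_forall fun r => abs_integral_corr_le hc hK h0 hmix _)
  have h1 : pathVariance P c B β t ε ω - t * sigmaConst P Q c B β =
      ∫ r in (0 : ℝ)..t, ∫ u in Ioi (0 : ℝ),
        (corr P c u.toNNReal (scaledIncrement B β ε r u ω) - sigmaIntegrand P Q c B β u) := by
    have h2 : ∀ r, ∫ u in Ioi (0 : ℝ),
        (corr P c u.toNNReal (scaledIncrement B β ε r u ω) - sigmaIntegrand P Q c B β u) =
        (∫ u in Ioi (0 : ℝ), corr P c u.toNNReal (scaledIncrement B β ε r u ω)) -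
          sigmaConst P Q c B β := fun r => integral_sub (hcorr r) hG
    simp only [h2]
    rw [intervalIntegral.integral_sub hrate intervalIntegrable_const]
    simp [pathVariance]
  rw [h1]
  simp only [intervalIntegral.integral_of_le ht]
  refine integral_integral_swap ?_
  have hbound : Integrable (fun p : ℝ × ℝ => 2 * (2 * K * K * alphaUm P c p.2))
      ((volume.restrict (Ioc 0 t)).prod (volume.restrict (Ioi 0))) :=
    Integrable.comp_snd ((hα.const_mul (2 * K * K)).const_mul 2) _
  have hmeas : Measurable (Function.uncurry fun r u : ℝ =>
      corr P c u.toNNReal (scaledIncrement B β ε r u ω) - sigmaIntegrand P Q c B β u) :=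
    (hm.comp (f := fun p : ℝ × ℝ => (p, ω)) (by fun_prop)).sub
      ((stronglyMeasurable_sigmaIntegrand hc hBm β).measurable.comp measurable_snd)
  refine Integrable.mono' hbound hmeas.aestronglyMeasurable ?_
  have hpos : ∀ᵐ p ∂((volume.restrict (Ioc 0 t)).prod (volume.restrict (Ioi (0 : ℝ)))),
      p.2 ∈ Ioi (0 : ℝ) :=
    Measure.quasiMeasurePreserving_snd.ae (ae_restrict_mem measurableSet_Ioi)
  filter_upwards [hpos] with p hp
  have h3 := abs_corr_le (P := P) hc hK h0 (le_of_lt hp) (scaledIncrement B β ε p.1 p.2 ω)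
  have h4 := abs_sigmaIntegrand_le (Q := Q) (B := B) hc hK h0 β (le_of_lt hp)
  refine (abs_sub _ _).trans ?_
  linarith

/-- The conditional variance of the exponent converges in mean. -/
theorem tendsto_integral_abs_pathVariance_sub
    (hc : Measurable fun p : (ℝ≥0 × ℝ) × S => c p.1.1 p.1.2 p.2)
    (hK : ∀ t x s, |c t x s| ≤ K) (hstat : Stationary P c)
    (h0 : ∀ t x, ∫ s, c t x s ∂P = 0) (hmix : HUm P c)
    (hB : IsPreBrownianReal B Q) (hBm : Measurable (Function.uncurry B)) {β : ℝ}
    (hβ : β ≤ 1 / 2) {t : ℝ} (ht : 0 ≤ t) :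
    Tendsto (fun ε => ∫ ω, |pathVariance P c B β t ε ω - t * sigmaConst P Q c B β| ∂Q)
      (𝓝[>] 0) (𝓝 0) := by
  have hα := integrableOn_alphaUm hmix
  set A : ℝ → ℝ → Ω → ℝ := fun ε u ω => ∫ r in (0 : ℝ)..t,
    (corr P c u.toNNReal (scaledIncrement B β ε r u ω) - sigmaIntegrand P Q c B β u) with hA
  have hAm : ∀ ε, Measurable (Function.uncurry (A ε)) := by
    intro ε
    have h1 := (measurable_corr_scaledIncrement (P := P) hc hBm β ε).comp
      (f := fun p : (ℝ × Ω) × ℝ => ((p.2, p.1.1), p.1.2)) (by fun_prop)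
    have h2 := (stronglyMeasurable_sigmaIntegrand (P := P) (Q := Q) hc hBm β).measurable.comp
      (f := fun p : (ℝ × Ω) × ℝ => p.1.1) (by fun_prop)
    have h3 := ((h1.sub h2).stronglyMeasurable.integral_prod_right'
      (ν := volume.restrict (Ioc 0 t))).measurable
    simp only [hA, intervalIntegral.integral_of_le ht]
    exact h3
  have hAb : ∀ ε u ω, 0 ≤ u → |A ε u ω| ≤ 2 * (2 * K * K * alphaUm P c u) * t := by
    intro ε u ω hu
    refine abs_intervalIntegral_le_const ht fun r _ => (abs_sub _ _).trans ?_
    have h3 := abs_corr_le (P := P) hc hK h0 hu (scaledIncrement B β ε r u ω)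
    have h4 := abs_sigmaIntegrand_le (Q := Q) (B := B) hc hK h0 β hu
    linarith
  have hbi : IntegrableOn (fun u => 2 * (2 * K * K * alphaUm P c u) * t) (Ioi 0) :=
    ((hα.const_mul (2 * K * K)).const_mul 2).mul_const t
  have hAi : ∀ ε, Integrable (Function.uncurry fun (ω : Ω) (u : ℝ) => |A ε u ω|)
      (Q.prod (volume.restrict (Ioi 0))) := by
    intro ε
    refine Integrable.mono' (Integrable.comp_snd hbi Q)
      ((hAm ε).comp measurable_swap).abs.aestronglyMeasurable ?_
    have hpos : ∀ᵐ p ∂(Q.prod (volume.restrict (Ioi (0 : ℝ)))), p.2 ∈ Ioi (0 : ℝ) :=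
      Measure.quasiMeasurePreserving_snd.ae (ae_restrict_mem measurableSet_Ioi)
    filter_upwards [hpos] with p hp
    change |(|A ε p.2 p.1|)| ≤ _
    rw [abs_abs]
    exact hAb ε p.2 p.1 (le_of_lt hp)
  have hle : ∀ ε, ∫ ω, |pathVariance P c B β t ε ω - t * sigmaConst P Q c B β| ∂Q ≤
      ∫ u in Ioi (0 : ℝ), ∫ ω, |A ε u ω| ∂Q := by
    intro ε
    rw [← integral_integral_swap (hAi ε)]
    refine integral_mono_of_nonneg (Eventually.of_forall fun ω => abs_nonneg _)
      (hAi ε).integral_prod_left (Eventually.of_forall fun ω => ?_)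
    dsimp only
    rw [pathVariance_sub_eq hc hK h0 hmix hBm ht β ε ω]
    exact abs_integral_le_integral_abs
  -- Dominated convergence in the lag: the averages converge for each `u`, with a majorant
  -- proportional to the integrable mixing coefficient.
  have hlim : Tendsto (fun ε => ∫ u in Ioi (0 : ℝ), ∫ ω, |A ε u ω| ∂Q) (𝓝[>] 0)
      (𝓝 (∫ _ in Ioi (0 : ℝ), (0 : ℝ))) := by
    refine tendsto_integral_filter_of_dominated_convergence
      (fun u => 2 * (2 * K * K * alphaUm P c u) * t) (Eventually.of_forall fun ε =>
        ((hAm ε).abs.stronglyMeasurable.integral_prod_right' (ν := Q)).aestronglyMeasurable)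
      (Eventually.of_forall fun ε => ?_) hbi ?_
    · filter_upwards [ae_restrict_mem measurableSet_Ioi] with u hu
      refine abs_integral_le_of_abs_le_const fun ω => ?_
      rw [abs_abs]
      exact hAb ε u ω (le_of_lt hu)
    · filter_upwards [ae_restrict_mem measurableSet_Ioi] with u hu
      exact tendsto_integral_abs_average hB hBm hβ ht (le_of_lt hu)
        (measurable_corr_apply hc u.toNNReal)
        (fun x => abs_corr_le hc hK h0 (le_of_lt hu) x) (tendsto_corr_zero hc hK hstat _)
  rw [integral_zero] at hlim
  exact squeeze_zero (fun ε => integral_nonneg fun ω => abs_nonneg _) hle hlim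

end Brownian

/-! ### A jointly measurable version of Brownian motion -/

/-- A Brownian motion has a jointly measurable version with almost surely the same paths. -/
theorem exists_measurable_version {Ω : Type*} [MeasurableSpace Ω] {Q : Measure Ω}
    {B : ℝ≥0 → Ω → ℝ} (hB : IsBrownianReal B Q) :
    ∃ B' : ℝ≥0 → Ω → ℝ, Measurable (Function.uncurry B') ∧ IsPreBrownianReal B' Q ∧
      ∀ᵐ ω ∂Q, ∀ t, B t ω = B' t ω := by
  set d := TopologicalSpace.denseSeq ℝ≥0
  have hae : ∀ᵐ ω ∂Q, Continuous (B · ω) ∧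
      ∀ n, B (d n) ω = (hB.aemeasurable (d n)).mk _ ω :=
    hB.cont.and (ae_all_iff.2 fun n => (hB.aemeasurable (d n)).ae_eq_mk)
  -- Off a single measurable null set `N`, paths are continuous and agree with measurable
  -- representatives along a dense sequence of times. Replacing the paths on `N` by zero makes every
  -- path continuous, and measurability at any time follows as a limit along that sequence.
  obtain ⟨N, hNsub, hNm, hN0⟩ := exists_measurable_superset_of_null (ae_iff.1 hae)
  have hgood : ∀ ω ∈ Nᶜ, Continuous (B · ω) ∧
      ∀ n, B (d n) ω = (hB.aemeasurable (d n)).mk _ ω := fun ω hω =>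
    by_contra fun h => hω (hNsub h)
  set B' : ℝ≥0 → Ω → ℝ := fun t => Nᶜ.indicator (B t) with hB'
  have hcont : ∀ ω, Continuous fun t => B' t ω := by
    intro ω
    by_cases hω : ω ∈ Nᶜ
    · simp only [hB', indicator_of_mem hω]
      exact (hgood ω hω).1
    · simp only [hB', indicator_of_notMem hω]
      exact continuous_const
  have hdm : ∀ n, Measurable (B' (d n)) := by
    intro n
    have h1 : B' (d n) = Nᶜ.indicator ((hB.aemeasurable (d n)).mk _) :=
      indicator_congr fun ω hω => (hgood ω hω).2 n
    rw [h1]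
    exact (hB.aemeasurable (d n)).measurable_mk.indicator hNm.compl
  have hm : ∀ t, Measurable (B' t) := by
    intro t
    obtain ⟨y, hy, hyt⟩ := mem_closure_iff_seq_limit.1
      ((TopologicalSpace.denseRange_denseSeq ℝ≥0) t)
    refine measurable_of_tendsto_metrizable (f := fun k => B' (y k)) (fun k => ?_) ?_
    · obtain ⟨n, hn⟩ := hy k
      rw [← hn]
      exact hdm n
    · exact tendsto_pi_nhds.2 fun ω => ((hcont ω).tendsto t).comp hyt
  have heq : ∀ᵐ ω ∂Q, ∀ t, B t ω = B' t ω := by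
    have h1 : ∀ᵐ ω ∂Q, ω ∈ Nᶜ := by
      rw [ae_iff]
      simpa using hN0
    filter_upwards [h1] with ω hω t
    simp only [hB', indicator_of_mem hω]
  exact ⟨B', measurable_uncurry_of_continuous_of_measurable hcont hm,
    hB.toIsPreBrownianReal.congr fun t => heq.mono fun ω h => h t, heq⟩

/-! ### Convergence in probability -/

section Conclusion

variable {S Ω : Type*} [MeasurableSpace S] [MeasurableSpace Ω] {P : Measure S}
  [IsProbabilityMeasure P] {Q : Measure Ω} [IsProbabilityMeasure Q] {c : ℝ≥0 → ℝ → S → ℝ}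
  {B : ℝ≥0 → Ω → ℝ} {K : ℝ}

/-- The bound holds for every `ω` with a deterministic right-hand side. The starting point `x` drops
out because the covariances depend only on increments of the path. -/
theorem abs_integral_exp_exponent_sub_le
    (hc : Measurable fun p : (ℝ≥0 × ℝ) × S => c p.1.1 p.1.2 p.2)
    (hK : ∀ t x s, |c t x s| ≤ K) (hstat : Stationary P c)
    (h0 : ∀ t x, ∫ s, c t x s ∂P = 0) (hmix : HUm P c)
    (hBm : Measurable (Function.uncurry B)) (β : ℝ) (t : ℝ≥0) (x : ℝ) {ε : ℝ} (hε : 0 < ε)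
    (ω : Ω) :
    |∫ σ, Real.exp (exponent c B β t x ε ω σ) ∂P - Real.exp (pathVariance P c B β t ε ω)| ≤
      Real.exp (2 * (∫ u in Ioi (0 : ℝ), 2 * K * K * alphaUm P c u) * t) *
        WeaklyDependent.comparisonError ε K (ε ^ (-(1 / 4) : ℝ)) t
          (fun u => 2 * K * K * alphaUm P c u) := by
  set X : ℝ → ℝ := fun r => (x + B r.toNNReal ω) / ε ^ β with hX
  have hXm : Measurable X := by
    have h1 : Measurable fun r : ℝ => B r.toNNReal ω :=
      hBm.comp (f := fun r : ℝ => (r.toNNReal, ω)) (by fun_prop)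
    exact (h1.const_add x).div_const _
  have h := (weaklyDependent_fieldAlong hc hK h0 hε hXm).abs_expMoment_sub_exp_le hε
    ((integrableOn_alphaUm hmix).const_mul (2 * K * K)) (Real.rpow_nonneg hε.le (-(1 / 4)))
    t.coe_nonneg
  have h1 : ∫ r in (0 : ℝ)..t, lagRate P ε (fieldAlong c ε X) r = pathVariance P c B β t ε ω := by
    refine intervalIntegral.integral_congr fun r hr => ?_
    rw [uIcc_of_le t.coe_nonneg] at hr
    refine setIntegral_congr_fun measurableSet_Ioi fun u hu => ?_
    rw [lagCov_fieldAlong hc hstat hε X hr.1 (le_of_lt hu)]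
    congr 1
    simp only [hX, scaledIncrement]
    ring
  rw [h1] at h
  exact h

theorem tendstoInMeasure_integral_exp_exponent
    (hc : Measurable fun p : (ℝ≥0 × ℝ) × S => c p.1.1 p.1.2 p.2)
    (hK : ∀ t x s, |c t x s| ≤ K) (hstat : Stationary P c)
    (h0 : ∀ t x, ∫ s, c t x s ∂P = 0) (hmix : HUm P c)
    (hB : IsPreBrownianReal B Q) (hBm : Measurable (Function.uncurry B)) {β : ℝ}
    (hβ : β ≤ 1 / 2) (t : ℝ≥0) (x : ℝ) :
    TendstoInMeasure Q (fun (ε : ℝ) (ω : Ω) => ∫ σ, Real.exp (exponent c B β t x ε ω σ) ∂P)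
      (𝓝[>] 0) (fun _ => Real.exp (t * sigmaConst P Q c B β)) := by
  have hK0 : 0 ≤ K := by
    obtain ⟨s⟩ := nonempty_of_isProbabilityMeasure P
    exact (abs_nonneg _).trans (hK 0 0 s)
  set θ : ℝ → ℝ := fun u => 2 * K * K * alphaUm P c u
  have hθ : IntegrableOn θ (Ioi 0) := (integrableOn_alphaUm hmix).const_mul _
  have hθ0 : ∀ u, 0 ≤ u → 0 ≤ θ u := fun u _ => by
    have := alphaUm_nonneg (P := P) (c := c) u
    positivity
  have hθlim : Tendsto θ atTop (𝓝 0) := by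
    simpa using (tendsto_alphaUm hmix).const_mul (2 * K * K)
  set C := ∫ u in Ioi (0 : ℝ), θ u
  have hη := (tendsto_comparisonError hθ0 hθ hθlim hK0 t.coe_nonneg).const_mul
    (Real.exp (2 * C * t))
  rw [mul_zero] at hη
  have hJ := tendsto_integral_abs_pathVariance_sub hc hK hstat h0 hmix hB hBm hβ t.coe_nonneg
  have hS : |t * sigmaConst P Q c B β| ≤ C * t := by
    rw [abs_mul, abs_of_nonneg t.coe_nonneg, mul_comm]
    refine mul_le_mul_of_nonneg_right (abs_integral_le_of_abs_le hθ ?_) t.coe_nonneg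
    filter_upwards [ae_restrict_mem measurableSet_Ioi] with u hu
    exact abs_sigmaIntegrand_le hc hK h0 β (le_of_lt hu)
  have hJi : ∀ ε, Integrable
      (fun ω => |pathVariance P c B β t ε ω - t * sigmaConst P Q c B β|) Q := by
    intro ε
    refine Integrable.of_bound ((measurable_pathVariance hc hBm β t ε).sub_const
      _).abs.aestronglyMeasurable (C * t + C * t) (Eventually.of_forall fun ω => ?_)
    rw [Real.norm_eq_abs, abs_abs]
    exact (abs_sub _ _).trans
      (add_le_add (abs_pathVariance_le hc hK h0 hmix t.coe_nonneg β ε ω) hS)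
  rw [tendstoInMeasure_iff_measureReal_norm]
  intro δ hδ
  -- A deviation of at least `δ` leaves at least `δ / 2` for the two exponentials once the
  -- comparison error is below `δ / 2`. As `exp` is `exp(C t)`-Lipschitz below `C t`, `pathVariance`
  -- is then at least `d` away from its limit, and Markov's inequality applies.
  set d : ℝ := δ / 2 / Real.exp (C * t) with hd
  have hd0 : 0 < d := by positivity
  have hlim := hJ.const_mul d⁻¹
  rw [mul_zero] at hlim
  refine squeeze_zero' (Eventually.of_forall fun ε => measureReal_nonneg) ?_ hlim
  filter_upwards [self_mem_nhdsWithin, hη.eventually (gt_mem_nhds (half_pos hδ))] with ε hε hηε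
  have hmarkov := mul_meas_ge_le_integral_of_nonneg
    (Eventually.of_forall fun ω => abs_nonneg _) (hJi ε) d
  rw [inv_mul_eq_div, le_div_iff₀' hd0]
  refine le_trans ?_ hmarkov
  refine mul_le_mul_of_nonneg_left (measureReal_mono fun ω hω => ?_) hd0.le
  have hω' : δ ≤ |∫ σ, Real.exp (exponent c B β t x ε ω σ) ∂P -
      Real.exp (t * sigmaConst P Q c B β)| := hω
  have h1 := abs_integral_exp_exponent_sub_le hc hK hstat h0 hmix hBm β t x hε ω
  have h2 := abs_exp_sub_exp_le (C := C * t)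
    ((le_abs_self _).trans (abs_pathVariance_le (B := B) hc hK h0 hmix t.coe_nonneg β ε ω))
    ((le_abs_self _).trans hS)
  have h3 := abs_sub_le (∫ σ, Real.exp (exponent c B β t x ε ω σ) ∂P)
    (Real.exp (pathVariance P c B β t ε ω)) (Real.exp (t * sigmaConst P Q c B β))
  change d ≤ |pathVariance P c B β t ε ω - t * sigmaConst P Q c B β|
  rw [hd, div_le_iff₀' (Real.exp_pos _)]
  linarith

end Conclusion

end RandomPotential

theorem mainTheorem6 {S Ω : Type*} [MeasurableSpace S] [MeasurableSpace Ω]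
    (P : Measure S) [IsProbabilityMeasure P] (Q : Measure Ω) [IsProbabilityMeasure Q]
    (c : ℝ≥0 → ℝ → S → ℝ) (B : ℝ≥0 → Ω → ℝ)
    (hc_meas : Measurable (fun p : (ℝ≥0 × ℝ) × S => c p.1.1 p.1.2 p.2))
    (hc_bdd : ∃ K : ℝ, ∀ t x s, |c t x s| ≤ K)
    (hc_stat : RandomPotential.Stationary P c)
    (hc_centered : ∀ t x, ∫ s, c t x s ∂P = 0)
    (hc_mix : RandomPotential.HUm P c)
    (hB : IsBrownianReal B Q)
    (β : ℝ) (hβ0 : 0 ≤ β) (hβ : β ≤ 1 / 2) (t : ℝ≥0) (x : ℝ) :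
    IntegrableOn (RandomPotential.sigmaIntegrand P Q c B β) (Ioi (0 : ℝ)) ∧
      TendstoInMeasure Q
        (fun (ε : ℝ) (ω : Ω) =>
          ∫ σ, Real.exp (RandomPotential.exponent c B β t x ε ω σ) ∂P)
        (𝓝[>] 0)
        (fun _ => Real.exp (t * RandomPotential.sigmaConst P Q c B β)) := by
  obtain ⟨K, hK⟩ := hc_bdd
  obtain ⟨B', hBm, hB', heq⟩ := RandomPotential.exists_measurable_version hB
  -- Passing to the measurable version leaves the limit constant unchanged and alters the exponents
  -- only on a null set.
  have hG : RandomPotential.sigmaIntegrand P Q c B β =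
      RandomPotential.sigmaIntegrand P Q c B' β := by
    funext u
    unfold RandomPotential.sigmaIntegrand
    congr 1
    refine integral_congr_ae ?_
    filter_upwards [heq] with ω hω
    rw [hω]
  have hS : RandomPotential.sigmaConst P Q c B β = RandomPotential.sigmaConst P Q c B' β := by
    unfold RandomPotential.sigmaConst
    rw [hG]
  rw [hG, hS]
  refine ⟨RandomPotential.integrableOn_sigmaIntegrand hc_meas hK hc_centered hc_mix hBm β,
    (RandomPotential.tendstoInMeasure_integral_exp_exponent hc_meas hK hc_stat hc_centered hc_mix
      hB' hBm hβ t x).congr_left fun ε => ?_⟩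
  filter_upwards [heq] with ω hω
  simp only [RandomPotential.exponent, hω]
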